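/- For $n=0,1,2,\dots$ let $$I_n=i(-1)^{n+1}\int_{-1-2i}^{-1+2i}\frac{5x^{2n}(x+1+2i)^{2n}(x+1-2i)^{2n}(x-1+2i)^{2n}(x-1-2i)^{2n}}{(5+x)^{3n+1}(5-x)^{3n+1}}\,dx,$$ where the integral is taken along the straight line segment from $-1-2i$ to $-1+2i$. Then for every $n$ there are unique rational numbers $a_n,b_n$ with $I_n=a_n+b_n\pi$; we have $b_n>0$ for all sufficiently large $n$, and $$\limsup_{n\to\infty}|I_n|^{1/n}=|N_1|=0.029458495928\dots,\qquad \lim_{n\to\infty}b_n^{1/n}=N_3=21851.691396\dots,$$ where $$N_{1,2}=0.02930189\dots\pm i\,0.00303351\dots,\qquad N_3=21851.691396\dots$$ are the zeros of the polynomial $108N^3-2359989N^2+138304N-2048$; here $N_3$ is real, $N_2=\overline{N_1}$, and all decimal expansions are truncated. -/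

import Mathlib

open Complex MeasureTheory Filter Topology Polynomial

/-- The rational function `R_n(x)`, the integrand. -/
noncomputable def integrandR (n : ℕ) (x : ℂ) : ℂ :=
  5 * x ^ (2 * n) * (x + 1 + 2 * I) ^ (2 * n) * (x + 1 - 2 * I) ^ (2 * n)
      * (x - 1 + 2 * I) ^ (2 * n) * (x - 1 - 2 * I) ^ (2 * n)
    / ((5 + x) ^ (3 * n + 1) * (5 - x) ^ (3 * n + 1))

/-- The integral `I_n = i (-1)^(n+1) ∫ R_n(x) dx`, taken along the straight line segment
from `-1 - 2i` to `-1 + 2i`; the integrated 1-form at `x` is `R_n(x) dx`, that is,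
the linear map `h ↦ h * R_n(x)`. -/
noncomputable def integralI (n : ℕ) : ℂ :=
  I * (-1) ^ (n + 1) *
    ∫ᶜ x in Path.segment (-1 - 2 * I) (-1 + 2 * I),
      ContinuousLinearMap.toSpanSingleton ℂ (integrandR n x)

/-- The polynomial `108 N^3 - 2359989 N^2 + 138304 N - 2048`. -/
noncomputable def indicialPoly : ℂ[X] :=
  C 108 * X ^ 3 - C 2359989 * X ^ 2 + C 138304 * X - C 2048

/-! With w = (x² - 25)/5 the integrand becomes, up to sign, hⁿ w⁻¹ dx, where h = (w + 5)(5w² + 56w +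
160)²/w³. The moments ∫ hⁿ wᵏ dx are linked by expanding h and by integration by parts, without
boundary terms because 5w² + 56w + 160 vanishes at both endpoints. Integration by parts makes the
moments of multiples of the critical cubic of h smaller than the basic moments by a factor 1/n.
Modulo this cubic, multiplication by h acts on a three-dimensional space with the indicial
polynomial, up to scaling, as characteristic polynomial. Hence the moments of w⁻¹ satisfy a
constant-coefficient recurrence up to a relatively small error
(`IsMomentFamily.recurrence_isLittleO`), and a Poincaré-type argument (`tendsto_log_windowSize_div`)
leaves two possible growth rates, ‖N₁‖ and N₃.

The coefficients of π are residues of the same forms, so they obey the same relations; with I₀ = π/4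
this gives I_n = a_n + b_n π (`exists_rat_integralI`). Each sequence then selects its rate: |I_n| ≤
4ⁿ excludes N₃ (`norm_segMoment_le`), while b_n is positive and nondecreasing, which excludes ‖N₁‖ <
1 (`monotone_piCoeff`). Irrationality of π gives uniqueness and I_n ≠ 0. -/

/-! ### Moment families and integration by parts -/

/-- A family `L n k` behaves under `n ↦ n + 1` like the moments `∫ hⁿ wᵏ` of
`h = (w + 5) (5 w² + 56 w + 160)² / w³`. -/
def IsMomentFamily (L : ℕ → ℤ → ℂ) : Prop :=
  ∀ n k, L (n + 1) k = 128000 * L n (k + (-3)) + 115200 * L n (k + (-2))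
    + 41600 * L n (k + (-1)) + 7536 * L n k + 685 * L n (k + 1) + 25 * L n (k + 2)

/-- The moment of `wᵏ (2 w³ + 5 w² - 120 w - 480)`; the zeros of the cubic are the critical
points of `h`. -/
def criticalMoment (L : ℕ → ℤ → ℂ) (n : ℕ) (k : ℤ) : ℂ :=
  2 * L n (k + 3) + 5 * L n (k + 2) - 120 * L n (k + 1) - 480 * L n k

/-- The part of the integration by parts relation that does not grow with `n`. -/
def remainderMoment (L : ℕ → ℤ → ℂ) (n : ℕ) (k : ℤ) : ℂ :=
  25 * L n (k + 3) + 268 * L n (k + 2) + 720 * L n (k + 1)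
    + 2 * (k + 1) * (5 * L n (k + 3) + 81 * L n (k + 2) + 440 * L n (k + 1) + 800 * L n k)

/-- Integration by parts for `d (hⁿ x (5 w² + 56 w + 160) wᵏ⁺¹)`, where `x² = 5 (w + 5)`. -/
def IntegratesByParts (L : ℕ → ℤ → ℂ) (n : ℕ) : Prop :=
  ∀ k, 10 * n * criticalMoment L n k + remainderMoment L n k = 0

/-- Expanding one factor h of hⁿ⁺¹ writes the exact form for n + 1 as a combination of those for n
with k shifted by -3, …, 2, weighted by the coefficients of h. -/
theorem IsMomentFamily.integratesByParts {L : ℕ → ℤ → ℂ} (hL : IsMomentFamily L)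
    (h0 : IntegratesByParts L 0) (n : ℕ) : IntegratesByParts L n := by
  induction n with
  | zero => exact h0
  | succ n ih =>
    intro k
    have h := ih
    simp only [IntegratesByParts, criticalMoment, remainderMoment] at h ⊢
    rw [hL n (k + 3), hL n (k + 2), hL n (k + 1), hL n k]
    have a1 := h (k + (-3))
    have a2 := h (k + (-2))
    have a3 := h (k + (-1))
    have a4 := h k
    have a5 := h (k + 1)
    have a6 := h (k + 2)
    simp only [add_assoc, Int.reduceAdd, Int.reduceNeg, add_zero] at a1 a2 a3 a4 a5 a6 ⊢
    push_cast at a1 a2 a3 a4 a5 a6 ⊢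
    linear_combination 128000 * a1 + 115200 * a2 + 41600 * a3 + 7536 * a4 + 685 * a5 + 25 * a6

/-! ### Reduction to three basic moments and the approximate recurrence -/

/-- The sum of the norms of the three moments that span all others up to small errors. -/
noncomputable def basicSize (L : ℕ → ℤ → ℂ) (n : ℕ) : ℝ := ‖L n (-1)‖ + ‖L n 0‖ + ‖L n 1‖

/-- After division by c n + d the coefficients converge to a i / c, hence stay bounded; this needs
only c ≠ 0. -/
theorem isBigO_of_affine_mul_eq_sum {ι : Type*} (s : Finset ι) (a b : ι → ℝ) (c d : ℝ)
    (hc : c ≠ 0) {f : ℕ → ℂ} {g : ι → ℕ → ℂ} {T : ℕ → ℝ} (hg : ∀ i ∈ s, g i =O[atTop] T)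
    (h : ∀ n : ℕ, ((c * n + d : ℝ) : ℂ) * f n = ∑ i ∈ s, ((a i * n + b i : ℝ) : ℂ) * g i n) :
    f =O[atTop] T := by
  have hlim : Tendsto (fun n : ℕ => c + d * ((n : ℝ))⁻¹) atTop (𝓝 c) := by
    simpa using (tendsto_inv_atTop_nhds_zero_nat.const_mul d).const_add c
  have hd (a b : ℝ) : Tendsto (fun n : ℕ => (a * n + b) / (c * n + d)) atTop (𝓝 (a / c)) := by
    have h1 : Tendsto (fun n : ℕ => a + b * ((n : ℝ))⁻¹) atTop (𝓝 a) := by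
      simpa using (tendsto_inv_atTop_nhds_zero_nat.const_mul b).const_add a
    refine (h1.div hlim hc).congr' ?_
    filter_upwards [eventually_gt_atTop 0] with n hn
    have : (n : ℝ) ≠ 0 := by positivity
    rw [Pi.div_apply, ← mul_div_mul_left _ _ this]
    congr 1 <;> field_simp
  have hne : ∀ᶠ n : ℕ in atTop, c * n + d ≠ 0 := by
    filter_upwards [hlim.eventually_ne hc, eventually_gt_atTop 0] with n hn hn0 h2
    have : (n : ℝ) ≠ 0 := by positivity
    apply hn
    field_simp
    linarith
  have hO (a b : ℝ) :
      (fun n : ℕ => (((a * n + b) / (c * n + d) : ℝ) : ℂ)) =O[atTop] (fun _ => (1 : ℝ)) := by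
    rw [← Asymptotics.isBigO_norm_left]
    simp only [Complex.norm_real]
    exact ((hd a b).isBigO_one ℝ).norm_left
  have key : (fun n : ℕ => ∑ i ∈ s, (((a i * n + b i) / (c * n + d) : ℝ) : ℂ) * g i n)
      =O[atTop] T :=
    Asymptotics.IsBigO.fun_sum fun i hi => by simpa only [one_mul] using (hO _ _).mul (hg i hi)
  refine key.congr' ?_ EventuallyEq.rfl
  filter_upwards [hne] with n hn
  have hn' : ((c * n + d : ℝ) : ℂ) ≠ 0 := by exact_mod_cast hn
  simp only [Complex.ofReal_div, div_mul_eq_mul_div]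
  rw [← Finset.sum_div, ← h n, mul_div_cancel_left₀ _ hn']

/-- The relation is solved for its top moment, whose coefficient grows like 20 n;
`isBigO_moment_down` solves for the bottom one, with 4800 n. -/
theorem isBigO_moment_up {L : ℕ → ℤ → ℂ} (hI : ∀ n, IntegratesByParts L n) {T : ℕ → ℝ} (k : ℤ)
    (h0 : (fun n => L n k) =O[atTop] T) (h1 : (fun n => L n (k + 1)) =O[atTop] T)
    (h2 : (fun n => L n (k + 2)) =O[atTop] T) : (fun n => L n (k + 3)) =O[atTop] T := by
  refine isBigO_of_affine_mul_eq_sum (s := (Finset.univ : Finset (Fin 3)))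
    (g := ![fun n => L n k, fun n => L n (k + 1), fun n => L n (k + 2)])
    ![4800, 1200, -50] ![-1600 * (k + 1), -720 - 880 * (k + 1), -268 - 162 * (k + 1)]
    20 (25 + 10 * (k + 1)) (by norm_num) ?_ ?_
  · intro i _
    fin_cases i <;> assumption
  · intro n
    have := hI n k
    simp only [criticalMoment, remainderMoment] at this
    simp [Fin.sum_univ_three]
    linear_combination this

theorem isBigO_moment_down {L : ℕ → ℤ → ℂ} (hI : ∀ n, IntegratesByParts L n) {T : ℕ → ℝ} (k : ℤ)
    (h1 : (fun n => L n (k + 1)) =O[atTop] T) (h2 : (fun n => L n (k + 2)) =O[atTop] T)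
    (h3 : (fun n => L n (k + 3)) =O[atTop] T) : (fun n => L n k) =O[atTop] T := by
  refine isBigO_of_affine_mul_eq_sum (s := (Finset.univ : Finset (Fin 3)))
    (g := ![fun n => L n (k + 1), fun n => L n (k + 2), fun n => L n (k + 3)])
    ![-1200, 50, 20] ![720 + 880 * (k + 1), 268 + 162 * (k + 1), 25 + 10 * (k + 1)]
    4800 (-1600 * (k + 1)) (by norm_num) ?_ ?_
  · intro i _
    fin_cases i <;> assumption
  · intro n
    have := hI n k
    simp only [criticalMoment, remainderMoment] at this
    simp [Fin.sum_univ_three]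
    linear_combination -this

theorem isBigO_moment {L : ℕ → ℤ → ℂ} (hI : ∀ n, IntegratesByParts L n) (k : ℤ) :
    (fun n => L n k) =O[atTop] basicSize L := by
  suffices h : ∀ k : ℤ, (fun n => L n k) =O[atTop] basicSize L ∧
      (fun n => L n (k + 1)) =O[atTop] basicSize L ∧
      (fun n => L n (k + 2)) =O[atTop] basicSize L from (h k).1
  intro k
  induction k using Int.inductionOn' (b := -1) with
  | zero =>
    refine ⟨.of_bound 1 (.of_forall fun n => ?_), .of_bound 1 (.of_forall fun n => ?_),
      .of_bound 1 (.of_forall fun n => ?_)⟩ <;>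
    · have h0 := norm_nonneg (L n (-1))
      have h1 := norm_nonneg (L n 0)
      have h2 := norm_nonneg (L n 1)
      rw [one_mul, Real.norm_of_nonneg (by unfold basicSize; positivity)]
      norm_num [basicSize]
      try linarith
  | succ k _ ih =>
    obtain ⟨h0, h1, h2⟩ := ih
    refine ⟨h1, by simpa only [add_assoc, Int.reduceAdd] using h2, ?_⟩
    simpa only [add_assoc, Int.reduceAdd] using isBigO_moment_up hI k h0 h1 h2
  | pred k _ ih =>
    obtain ⟨h0, h1, h2⟩ := ih
    have e1 : k - 1 + 1 = k := by ring
    have e2 : k - 1 + 2 = k + 1 := by ring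
    have e3 : k - 1 + 3 = k + 2 := by ring
    refine ⟨isBigO_moment_down hI (k - 1) ?_ ?_ ?_, ?_, ?_⟩ <;> simpa only [e1, e2, e3]

theorem isLittleO_criticalMoment {L : ℕ → ℤ → ℂ} (hI : ∀ n, IntegratesByParts L n) (k : ℤ) :
    (fun n => criticalMoment L n k) =o[atTop] basicSize L := by
  have hO : (fun n => remainderMoment L n k) =O[atTop] basicSize L := by
    unfold remainderMoment
    have h := isBigO_moment hI
    exact (((((h _).const_mul_left _).add ((h _).const_mul_left _)).add
      ((h _).const_mul_left _))).add
      ((((((h _).const_mul_left _).add ((h _).const_mul_left _)).add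
        ((h _).const_mul_left _)).add ((h _).const_mul_left _)).const_mul_left _)
  have hn : (fun n : ℕ => -(1 / 10 : ℂ) * ((n : ℂ))⁻¹) =o[atTop] (fun _ => (1 : ℝ)) := by
    rw [Asymptotics.isLittleO_one_iff]
    have : Tendsto (fun n : ℕ => ((n : ℂ))⁻¹) atTop (𝓝 0) :=
      tendsto_inv_atTop_nhds_zero_nat
    simpa using this.const_mul (-(1 / 10 : ℂ))
  have := hn.mul_isBigO hO
  simp only [one_mul] at this
  refine this.congr' ?_ EventuallyEq.rfl
  filter_upwards [eventually_gt_atTop 0] with n hn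
  have h0 : (n : ℂ) ≠ 0 := by exact_mod_cast hn.ne'
  have := hI n k
  field_simp
  linear_combination -this

/-- The size of three consecutive terms of a sequence. -/
noncomputable def windowSize (a : ℕ → ℂ) (n : ℕ) : ℝ := ‖a n‖ + ‖a (n + 1)‖ + ‖a (n + 2)‖

/-- Modulo the critical cubic, w⁻¹, h w⁻¹, h² w⁻¹ span the same space as w⁻¹, 1, w. The errors of
this change of basis are o(`basicSize`) and can be absorbed on the left. -/
theorem IsMomentFamily.basicSize_isBigO {L : ℕ → ℤ → ℂ} (hL : IsMomentFamily L)
    (h0 : IntegratesByParts L 0) : basicSize L =O[atTop] windowSize (fun n => L n (-1)) := by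
  have hI := hL.integratesByParts h0
  set M := windowSize (fun n => L n (-1)) with hM
  have hC (k : ℤ) := isLittleO_criticalMoment hI k
  have e0 : ∃ r : ℕ → ℂ, r =o[atTop] basicSize L ∧ ∀ n, 7459400 * L n 0 =
      -25570112 * L n (-1) + -497952351 * L (n + 1) (-1) + 22788 * L (n + 2) (-1) + r n := by
    -- These are the coefficients of the quotient by the critical cubic when 1 is expressed through
    -- w⁻¹, h w⁻¹, h² w⁻¹; the next block does the same for w.
    refine ⟨fun n => 777830400000 * criticalMoment L n (-7)
      + 1205637120000 * criticalMoment L n (-6) + 842325504000 * criticalMoment L n (-5)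
      + 219051324000 * criticalMoment L n (-4) + 12440445400 * criticalMoment L n (-3)
      + (-2911376025) * criticalMoment L n (-2) + (-372441375) * criticalMoment L n (-1)
      + (-7121250) * criticalMoment L n 0, ?_, fun n => ?_⟩
    · repeat' refine Asymptotics.IsLittleO.add ?_ ?_
      all_goals exact (hC _).const_mul_left _
    · rw [hL (n + 1)]
      simp only [hL n, criticalMoment, Int.reduceAdd, Int.reduceNeg]
      ring
  have e1 : ∃ r : ℕ → ℂ, r =o[atTop] basicSize L ∧ ∀ n, 932425 * L n 1 =
      7350688 * L n (-1) + 670237659 * L (n + 1) (-1) + -30672 * L (n + 2) (-1) + r n := by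
    refine ⟨fun n => (-1046937600000) * criticalMoment L n (-7)
      + (-1622753280000) * criticalMoment L n (-6) + (-1133746176000) * criticalMoment L n (-5)
      + (-294834732000) * criticalMoment L n (-4) + (-16743107000) * criticalMoment L n (-3)
      + 3918996125 * criticalMoment L n (-2) + 501295500 * criticalMoment L n (-1)
      + 9585000 * criticalMoment L n 0, ?_, fun n => ?_⟩
    · repeat' refine Asymptotics.IsLittleO.add ?_ ?_
      all_goals exact (hC _).const_mul_left _
    · rw [hL (n + 1)]
      simp only [hL n, criticalMoment, Int.reduceAdd, Int.reduceNeg]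
      ring
  obtain ⟨r, hr, er⟩ := e0
  obtain ⟨s, hs, es⟩ := e1
  have key : basicSize L =O[atTop] fun n => ‖M n‖ + (‖r n‖ + ‖s n‖) := by
    have hbd {c : ℂ} {c0 c1 c2 : ℂ} (hc : 1 ≤ ‖c‖) {x : ℂ} {y : ℂ} {z u v : ℂ}
        (h : c * x = c0 * u + c1 * v + c2 * z + y) :
        ‖x‖ ≤ ‖c0‖ * ‖u‖ + ‖c1‖ * ‖v‖ + ‖c2‖ * ‖z‖ + ‖y‖ := by
      calc ‖x‖ ≤ ‖c‖ * ‖x‖ := le_mul_of_one_le_left (norm_nonneg _) hc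
        _ = ‖c0 * u + c1 * v + c2 * z + y‖ := by rw [← h, norm_mul]
        _ ≤ _ := by
          refine (norm_add₄_le).trans ?_
          simp only [norm_mul]
          exact le_rfl
    -- Any constant above the sums of matching coefficients in the two identities works.
    refine .of_bound 4000000000 (.of_forall fun n => ?_)
    have b0 := hbd (by norm_num) (er n)
    have b1 := hbd (by norm_num) (es n)
    have h0 := norm_nonneg (L n (-1))
    have h1 := norm_nonneg (L (n + 1) (-1))
    have h2 := norm_nonneg (L (n + 2) (-1))
    have h3 := norm_nonneg (r n)
    have h4 := norm_nonneg (s n)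
    have hMn : ‖M n‖ = ‖L n (-1)‖ + ‖L (n + 1) (-1)‖ + ‖L (n + 2) (-1)‖ :=
      Real.norm_of_nonneg (by simp only [hM, windowSize]; positivity)
    rw [Real.norm_of_nonneg (show 0 ≤ basicSize L n by unfold basicSize; positivity),
      Real.norm_of_nonneg (show 0 ≤ ‖M n‖ + (‖r n‖ + ‖s n‖) by positivity), hMn, basicSize]
    norm_num at b0 b1
    linarith
  have hrs : (fun n => ‖r n‖ + ‖s n‖) =o[atTop] basicSize L := hr.norm_left.add hs.norm_left
  obtain ⟨K, hKpos, hK⟩ := key.exists_pos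
  have hsmall := hrs.bound (show 0 < 1 / (2 * K) by positivity)
  refine .of_bound (2 * K) ?_
  filter_upwards [hK.bound, hsmall] with n h1 h2
  rw [Real.norm_of_nonneg (show 0 ≤ ‖M n‖ + (‖r n‖ + ‖s n‖) by positivity)] at h1
  rw [Real.norm_of_nonneg (show 0 ≤ ‖r n‖ + ‖s n‖ by positivity)] at h2
  have h3 : K * (‖r n‖ + ‖s n‖) ≤ ‖basicSize L n‖ / 2 := by
    calc _ ≤ K * (1 / (2 * K) * ‖basicSize L n‖) := by gcongr
      _ = _ := by field_simp
  linarith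

/-- The moments of `w⁻¹` almost satisfy a linear recurrence with constant coefficients, whose
characteristic polynomial has the critical values of `h` as its zeros. -/
theorem IsMomentFamily.recurrence_isLittleO {L : ℕ → ℤ → ℂ} (hL : IsMomentFamily L)
    (h0 : IntegratesByParts L 0) :
    (fun n => 108 * L (n + 3) (-1) - 2359989 * L (n + 2) (-1) + 138304 * L (n + 1) (-1)
      - 2048 * L n (-1)) =o[atTop] windowSize (fun n => L n (-1)) := by
  have hC (k : ℤ) := isLittleO_criticalMoment (hL.integratesByParts h0) k
  refine Asymptotics.IsLittleO.trans_isBigO ?_ (hL.basicSize_isBigO h0)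
  -- The indicial polynomial evaluated at h, times w⁻¹, is divisible by the critical cubic; the
  -- thirteen numbers are the coefficients of the quotient.
  have : (fun n => 108 * L (n + 3) (-1) - 2359989 * L (n + 2) (-1) + 138304 * L (n + 1) (-1)
      - 2048 * L n (-1)) = fun n => 843750 * criticalMoment L n 2
        + 67246875 * criticalMoment L n 1 + 1808392500 * criticalMoment L n 0
        + 22683648375 * criticalMoment L n (-1) + 114961805000 * criticalMoment L n (-2)
        + (-473544420000) * criticalMoment L n (-3)
        + (-11337898240000) * criticalMoment L n (-4)
        + (-82302812800000) * criticalMoment L n (-5)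
        + (-338796416000000) * criticalMoment L n (-6)
        + (-858248908800000) * criticalMoment L n (-7)
        + (-1322582016000000) * criticalMoment L n (-8)
        + (-1156055040000000) * criticalMoment L n (-9)
        + (-471859200000000) * criticalMoment L n (-10) := by
    funext n
    rw [hL (n + 2)]
    simp only [hL (n + 1), Int.reduceAdd, Int.reduceNeg]
    simp only [hL n, criticalMoment, Int.reduceAdd, Int.reduceNeg]
    ring
  rw [this]
  repeat' refine Asymptotics.IsLittleO.add ?_ ?_
  all_goals exact (hC _).const_mul_left _

/-! ### Growth rates of perturbed linear recurrences -/

/-- The ratio of consecutive terms tends to r, so the increments of log T tend to log r, and Cesàro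
averaging finishes. -/
theorem tendsto_log_div_of_ratio {T : ℕ → ℝ} {r : ℝ} (hr : 0 < r) (hT : ∀ᶠ n in atTop, 0 < T n)
    (h : (fun n => T (n + 1) - r * T n) =o[atTop] T) :
    Tendsto (fun n : ℕ => Real.log (T n) / n) atTop (𝓝 (Real.log r)) := by
  have h1 : Tendsto (fun n => T (n + 1) / T n) atTop (𝓝 r) := by
    have h2 := (h.tendsto_div_nhds_zero).add_const r
    rw [zero_add] at h2
    refine h2.congr' ?_
    filter_upwards [hT] with n hn
    field_simp
    ring
  have h3 : Tendsto (fun n => Real.log (T (n + 1)) - Real.log (T n)) atTop (𝓝 (Real.log r)) := by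
    refine (h1.log hr.ne').congr' ?_
    filter_upwards [hT, (tendsto_add_atTop_nat 1).eventually hT] with n hn hn1
    exact Real.log_div hn1.ne' hn.ne'
  have h4 := h3.cesaro.add
    ((tendsto_inv_atTop_nhds_zero_nat (𝕜 := ℝ)).mul_const (Real.log (T 0)))
  simp only [zero_mul, add_zero] at h4
  refine h4.congr fun n => ?_
  rw [Finset.sum_range_sub (fun n => Real.log (T n))]
  ring

theorem tendsto_log_div_of_isTheta {T M : ℕ → ℝ} {l : ℝ} (hT : ∀ᶠ n in atTop, 0 < T n)
    (hM : ∀ᶠ n in atTop, 0 < M n) (hTM : T =O[atTop] M) (hMT : M =O[atTop] T)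
    (h : Tendsto (fun n : ℕ => Real.log (T n) / n) atTop (𝓝 l)) :
    Tendsto (fun n : ℕ => Real.log (M n) / n) atTop (𝓝 l) := by
  obtain ⟨K, hK, hK'⟩ := hTM.exists_pos
  obtain ⟨J, hJ, hJ'⟩ := hMT.exists_pos
  have hlow := h.sub (tendsto_const_div_atTop_nhds_zero_nat (Real.log K))
  have hup := h.add (tendsto_const_div_atTop_nhds_zero_nat (Real.log J))
  rw [sub_zero] at hlow
  rw [add_zero] at hup
  refine tendsto_of_tendsto_of_tendsto_of_le_of_le' hlow hup ?_ ?_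
  · filter_upwards [hT, hM, hK'.bound] with n h1 h2 h3
    rw [Real.norm_of_nonneg h1.le, Real.norm_of_nonneg h2.le] at h3
    rw [← sub_div]
    gcongr
    have := Real.log_le_log h1 h3
    rw [Real.log_mul hK.ne' h2.ne'] at this
    linarith
  · filter_upwards [hT, hM, hJ'.bound] with n h1 h2 h3
    rw [Real.norm_of_nonneg h1.le, Real.norm_of_nonneg h2.le] at h3
    rw [← add_div]
    gcongr
    have := Real.log_le_log h2 h3
    rw [Real.log_mul hJ.ne' h1.ne'] at this
    linarith

/-- Two nonnegative sequences that grow like `ρⁿ` and `Rⁿ` up to small mutual perturbations: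
one of them dominates in the end. -/
theorem tendsto_log_add_div_of_perturbed {S Z : ℕ → ℝ} {ρ R : ℝ} (hρ : 0 < ρ) (hR : ρ < R)
    (hS0 : ∀ n, 0 ≤ S n) (hZ0 : ∀ n, 0 ≤ Z n) (hpos : ∀ᶠ n in atTop, 0 < S n + Z n)
    (hS : (fun n => S (n + 1) - ρ * S n) =o[atTop] fun n => S n + Z n)
    (hZ : (fun n => Z (n + 1) - R * Z n) =o[atTop] fun n => S n + Z n) :
    Tendsto (fun n : ℕ => Real.log (S n + Z n) / n) atTop (𝓝 (Real.log ρ)) ∨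
      Tendsto (fun n : ℕ => Real.log (S n + Z n) / n) atTop (𝓝 (Real.log R)) := by
  have hSa : ∀ n, |S n + Z n| = S n + Z n := fun n => abs_of_nonneg (add_nonneg (hS0 n) (hZ0 n))
  -- With errors at most ε(S + Z), S ≤ Z gives Z' - S' ≥ RZ - ρS - 2ε(S + Z) ≥ ρ(Z - S) ≥ 0, so
  -- dominance of Z persists once it occurs late enough.
  have hε : 0 < (R - ρ) / 4 := by linarith
  by_cases hex : ∃ᶠ n in atTop, S n ≤ Z n
  · right
    have hev : ∀ᶠ n in atTop, S n ≤ Z n := by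
      obtain ⟨m, hm⟩ := eventually_atTop.1 ((hS.bound hε).and (hZ.bound hε))
      obtain ⟨k, hkm, hk⟩ := frequently_atTop.1 hex m
      refine eventually_atTop.2 ⟨k, fun n hn => ?_⟩
      induction n, hn using Nat.le_induction with
      | base => exact hk
      | succ n hn ih =>
        obtain ⟨h1, h2⟩ := hm n (hkm.trans hn)
        rw [Real.norm_eq_abs, Real.norm_eq_abs, hSa] at h1 h2
        have h3 := (abs_le.1 h1).2
        have h4 := (abs_le.1 h2).1
        nlinarith [hS0 n, hZ0 n]
    have hO : (fun n => S n + Z n) =O[atTop] Z := by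
      refine .of_bound 2 ?_
      filter_upwards [hev] with n hn
      rw [Real.norm_eq_abs, hSa, Real.norm_of_nonneg (hZ0 n)]
      linarith
    have hO' : Z =O[atTop] fun n => S n + Z n := by
      refine .of_bound 1 (.of_forall fun n => ?_)
      rw [Real.norm_eq_abs (S n + Z n), hSa, Real.norm_of_nonneg (hZ0 n)]
      linarith [hS0 n]
    have hZpos : ∀ᶠ n in atTop, 0 < Z n := by
      filter_upwards [hev, hpos] with n h1 h2
      linarith
    exact tendsto_log_div_of_isTheta hZpos hpos hO' hO
      (tendsto_log_div_of_ratio (hρ.trans hR) hZpos (hZ.trans_isBigO hO))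
  · left
    have hev : ∀ᶠ n in atTop, Z n < S n := by
      simpa only [not_frequently, not_le] using hex
    have hO : (fun n => S n + Z n) =O[atTop] S := by
      refine .of_bound 2 ?_
      filter_upwards [hev] with n hn
      rw [Real.norm_eq_abs, hSa, Real.norm_of_nonneg (hS0 n)]
      linarith
    have hO' : S =O[atTop] fun n => S n + Z n := by
      refine .of_bound 1 (.of_forall fun n => ?_)
      rw [Real.norm_eq_abs (S n + Z n), hSa, Real.norm_of_nonneg (hS0 n)]
      linarith [hZ0 n]
    have hSpos : ∀ᶠ n in atTop, 0 < S n := by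
      filter_upwards [hev, hpos] with n h1 h2
      linarith
    exact tendsto_log_div_of_isTheta hSpos hpos hO' hO
      (tendsto_log_div_of_ratio hρ hSpos (hS.trans_isBigO hO))

theorem windowSize_nonneg (a : ℕ → ℂ) (n : ℕ) : 0 ≤ windowSize a n := by
  unfold windowSize; positivity

/-- A solution of a perturbed third order recurrence with characteristic roots
`‖N₁‖ = ‖N₂‖ < ‖N₃‖` grows like `‖N₁‖ⁿ` or like `‖N₃‖ⁿ`. -/
theorem tendsto_log_windowSize_div {a : ℕ → ℂ} {N₁ N₂ N₃ : ℂ} (h12 : N₁ ≠ N₂) (h1 : N₁ ≠ 0)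
    (h21 : ‖N₂‖ = ‖N₁‖) (h13 : ‖N₁‖ < ‖N₃‖) (hpos : ∀ᶠ n in atTop, 0 < windowSize a n)
    (hrec : (fun n => a (n + 3) - (N₁ + N₂ + N₃) * a (n + 2)
      + (N₁ * N₂ + N₁ * N₃ + N₂ * N₃) * a (n + 1) - N₁ * N₂ * N₃ * a n)
        =o[atTop] windowSize a) :
    Tendsto (fun n : ℕ => Real.log (windowSize a n) / n) atTop (𝓝 (Real.log ‖N₁‖)) ∨
      Tendsto (fun n : ℕ => Real.log (windowSize a n) / n) atTop (𝓝 (Real.log ‖N₃‖)) := by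
  have hN13 : N₁ ≠ N₃ := by rintro rfl; exact lt_irrefl _ h13
  have hN23 : N₂ ≠ N₃ := by rintro rfl; rw [h21] at h13; exact lt_irrefl _ h13
  -- `proj p q` annihilates the geometric sequences of ratio `p` and `q`
  let proj : ℂ → ℂ → ℕ → ℂ := fun p q n => a (n + 2) - (p + q) * a (n + 1) + p * q * a n
  set x := proj N₂ N₃ with hx
  set y := proj N₁ N₃ with hy
  set z := proj N₁ N₂ with hz
  -- The components of ratios N₁ and N₂ have equal modulus, so their maximum serves as a single
  -- sequence of rate ‖N₁‖.
  let S : ℕ → ℝ := fun n => max ‖x n‖ ‖y n‖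
  let Z : ℕ → ℝ := fun n => ‖z n‖
  have hproj (p q : ℂ) : ∃ K, ∀ n, ‖proj p q n‖ ≤ K * windowSize a n := by
    refine ⟨1 + ‖p + q‖ + ‖p * q‖, fun n => ?_⟩
    have : ‖proj p q n‖ ≤ ‖a (n + 2)‖ + ‖p + q‖ * ‖a (n + 1)‖ + ‖p * q‖ * ‖a n‖ := by
      refine (norm_add_le _ _).trans ?_
      rw [norm_mul (p * q)]
      gcongr
      refine (norm_sub_le _ _).trans ?_
      rw [norm_mul]
    have h0 := norm_nonneg (a n)
    have h1 := norm_nonneg (a (n + 1))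
    have h2 := norm_nonneg (a (n + 2))
    have h3 := norm_nonneg (p + q)
    have h4 := norm_nonneg (p * q)
    unfold windowSize
    nlinarith [mul_nonneg h3 h0, mul_nonneg h3 h2, mul_nonneg h4 h1, mul_nonneg h4 h2]
  have hSZM : (fun n => S n + Z n) =O[atTop] windowSize a := by
    obtain ⟨K1, hK1⟩ := hproj N₂ N₃
    obtain ⟨K2, hK2⟩ := hproj N₁ N₃
    obtain ⟨K3, hK3⟩ := hproj N₁ N₂
    refine .of_bound (max K1 K2 + K3) (.of_forall fun n => ?_)
    have hM := windowSize_nonneg a n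
    rw [Real.norm_of_nonneg (show 0 ≤ S n + Z n by positivity), Real.norm_of_nonneg hM, add_mul]
    refine add_le_add (max_le ?_ ?_) (hK3 n)
    · exact (hK1 n).trans (by gcongr; exact le_max_left _ _)
    · exact (hK2 n).trans (by gcongr; exact le_max_right _ _)
  have hMSZ : windowSize a =O[atTop] fun n => S n + Z n := by
    have hO (α β γ : ℂ) : (fun n => α * x n + β * y n + γ * z n) =O[atTop]
        fun n => S n + Z n := by
      have hx : x =O[atTop] fun n => S n + Z n := by
        refine .of_bound 1 (.of_forall fun n => ?_)
        rw [one_mul, Real.norm_of_nonneg (show 0 ≤ S n + Z n by positivity)]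
        exact (le_max_left _ _).trans (le_add_of_nonneg_right (norm_nonneg _))
      have hy : y =O[atTop] fun n => S n + Z n := by
        refine .of_bound 1 (.of_forall fun n => ?_)
        rw [one_mul, Real.norm_of_nonneg (show 0 ≤ S n + Z n by positivity)]
        exact (le_max_right _ _).trans (le_add_of_nonneg_right (norm_nonneg _))
      have hz : z =O[atTop] fun n => S n + Z n := by
        refine .of_bound 1 (.of_forall fun n => ?_)
        rw [one_mul, Real.norm_of_nonneg (show 0 ≤ S n + Z n by positivity)]
        exact le_add_of_nonneg_left ((norm_nonneg _).trans (le_max_left _ _))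
      exact ((hx.const_mul_left _).add (hy.const_mul_left _)).add (hz.const_mul_left _)
    have d1 : (N₁ - N₂) ≠ 0 := sub_ne_zero.2 h12
    have d2 : (N₁ - N₃) ≠ 0 := sub_ne_zero.2 hN13
    have d3 : (N₂ - N₃) ≠ 0 := sub_ne_zero.2 hN23
    have e (i : ℕ) (hi : i ≤ 2) : (fun n => a (n + i)) =O[atTop] fun n => S n + Z n := by
      -- Lagrange interpolation at N₁, N₂, N₃ recovers a (n + i) from the three projections.
      refine (hO (N₁ ^ i / ((N₁ - N₂) * (N₁ - N₃))) (-N₂ ^ i / ((N₁ - N₂) * (N₂ - N₃)))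
        (N₃ ^ i / ((N₁ - N₃) * (N₂ - N₃)))).congr_left fun n => ?_
      simp only [hx, hy, hz, proj]
      field_simp
      interval_cases i <;> ring_nf
    unfold windowSize
    exact ((e 0 (by norm_num)).norm_left.add (e 1 (by norm_num)).norm_left).add
      (e 2 (by norm_num)).norm_left
  have hSZpos : ∀ᶠ n in atTop, 0 < S n + Z n := by
    obtain ⟨K, hK, hK'⟩ := hMSZ.exists_pos
    filter_upwards [hpos, hK'.bound] with n h1 h2
    rw [Real.norm_of_nonneg h1.le, Real.norm_of_nonneg (show 0 ≤ S n + Z n by positivity)] at h2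
    by_contra h
    nlinarith
  have hrec' := hrec.trans_isBigO hMSZ
  have hnorm {p : ℂ} {u : ℕ → ℂ} (hu : (fun n => u (n + 1) - p * u n) =o[atTop]
      fun n => S n + Z n) : (fun n => ‖u (n + 1)‖ - ‖p‖ * ‖u n‖) =o[atTop]
      fun n => S n + Z n := by
    refine Asymptotics.IsBigO.trans_isLittleO (.of_bound 1 (.of_forall fun n => ?_)) hu
    rw [one_mul, ← norm_mul]
    exact abs_norm_sub_norm_le _ _
  have hX : (fun n => ‖x (n + 1)‖ - ‖N₁‖ * ‖x n‖) =o[atTop] fun n => S n + Z n :=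
    hnorm (hrec'.congr_left fun n => by simp only [hx, proj]; ring)
  have hY : (fun n => ‖y (n + 1)‖ - ‖N₁‖ * ‖y n‖) =o[atTop] fun n => S n + Z n := by
    rw [← h21]
    exact hnorm (hrec'.congr_left fun n => by simp only [hy, proj]; ring)
  have hZ : (fun n => Z (n + 1) - ‖N₃‖ * Z n) =o[atTop] fun n => S n + Z n :=
    hnorm (hrec'.congr_left fun n => by simp only [hz, proj]; ring)
  have hS : (fun n => S (n + 1) - ‖N₁‖ * S n) =o[atTop] fun n => S n + Z n := by
    refine Asymptotics.IsBigO.trans_isLittleO (.of_bound 1 (.of_forall fun n => ?_))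
      (hX.norm_left.add hY.norm_left)
    rw [one_mul, Real.norm_eq_abs, Real.norm_of_nonneg (add_nonneg (norm_nonneg
      (‖x (n + 1)‖ - ‖N₁‖ * ‖x n‖)) (norm_nonneg (‖y (n + 1)‖ - ‖N₁‖ * ‖y n‖)))]
    simp only [S]
    rw [mul_max_of_nonneg _ _ (norm_nonneg N₁)]
    refine (abs_max_sub_max_le_max _ _ _ _).trans (max_le ?_ ?_)
    · exact le_add_of_nonneg_right (norm_nonneg _)
    · exact le_add_of_nonneg_left (norm_nonneg _)
  refine (tendsto_log_add_div_of_perturbed (norm_pos_iff.2 h1) h13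
    (fun n => (norm_nonneg _).trans (le_max_left _ _)) (fun n => norm_nonneg _) hSZpos hS hZ).imp
    ?_ ?_ <;>
  exact tendsto_log_div_of_isTheta hSZpos hpos hSZM hMSZ

/-! ### Numerical location of the characteristic roots -/

theorem indicialPoly_eq_of_factors {N₁ N₂ N₃ : ℂ} (h1 : N₁ + N₂ + N₃ = 2359989 / 108)
    (h2 : N₁ * N₂ + N₁ * N₃ + N₂ * N₃ = 138304 / 108) (h3 : N₁ * N₂ * N₃ = 2048 / 108) :
    indicialPoly.roots = {N₁, N₂, N₃} := by
  have e : indicialPoly =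
      C 108 * (({N₁, N₂, N₃} : Multiset ℂ).map fun a => X - C a).prod := by
    have e1 : (C 2359989 : ℂ[X]) = C 108 * (C N₁ + C N₂ + C N₃) := by
      rw [← C_add, ← C_add, ← C_mul, h1]; norm_num
    have e2 : (C 138304 : ℂ[X]) = C 108 * (C N₁ * C N₂ + C N₁ * C N₃ + C N₂ * C N₃) := by
      simp only [← C_add, ← C_mul, h2]; norm_num
    have e3 : (C 2048 : ℂ[X]) = C 108 * (C N₁ * C N₂ * C N₃) := by
      simp only [← C_mul, h3]; norm_num
    simp only [Multiset.insert_eq_cons, Multiset.map_cons, Multiset.map_singleton,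
      Multiset.prod_cons, Multiset.prod_singleton]
    rw [indicialPoly, e1, e2, e3]
    ring
  rw [e, roots_C_mul _ (by norm_num), roots_multiset_prod_X_sub_C]

/-- The bracket is this narrow because the real part of N₁ comes from the cancellation in
2359989/108 - N₃. -/
theorem exists_indicial_root : ∃ N : ℝ, N ∈ Set.Icc (21851.6913962195616 : ℝ) 21851.6913962195617 ∧
    108 * N ^ 3 - 2359989 * N ^ 2 + 138304 * N - 2048 = 0 := by
  have hc : ContinuousOn (fun N : ℝ => 108 * N ^ 3 - 2359989 * N ^ 2 + 138304 * N - 2048)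
      (Set.Icc (21851.6913962195616 : ℝ) 21851.6913962195617) := by fun_prop
  exact intermediate_value_Icc (by norm_num) hc ⟨by norm_num, by norm_num⟩

theorem exists_indicial_roots : ∃ (N₁ N₂ : ℂ) (N₃ : ℝ),
    indicialPoly.roots = {N₁, N₂, (N₃ : ℂ)} ∧
    (N₁ + N₂ + N₃ = 2359989 / 108 ∧ N₁ * N₂ + N₁ * N₃ + N₂ * N₃ = 138304 / 108 ∧
      N₁ * N₂ * N₃ = 2048 / 108) ∧
    (N₁.re ∈ Set.Ico (0.02930189 : ℝ) 0.02930190 ∧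
      N₁.im ∈ Set.Ico (0.00303351 : ℝ) 0.00303352) ∧
    N₂ = starRingEnd ℂ N₁ ∧
    N₃ ∈ Set.Ico (21851.691396 : ℝ) 21851.691397 ∧
    ‖N₁‖ ∈ Set.Ico (0.029458495928 : ℝ) 0.029458495929 := by
  obtain ⟨N, ⟨hl, hu⟩, hN⟩ := exists_indicial_root
  have hpos : 0 < N := by linarith
  -- By Vieta, s is half the sum and p the product of the conjugate pair, so the pair is s ± i√(p -
  -- s²) and ‖N₁‖ = √p.
  obtain ⟨s, hs⟩ : ∃ s, s = (2359989 / 108 - N) / 2 := ⟨_, rfl⟩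
  obtain ⟨p, hp⟩ : ∃ p, p = 2048 / 108 / N := ⟨_, rfl⟩
  have hpN : p * N = 2048 / 108 := by rw [hp]; field_simp
  have hsl : 0.02930189021910 ≤ s := by rw [hs]; norm_num at hu ⊢; linarith
  have hsu : s ≤ 0.02930189021920 := by rw [hs]; norm_num at hl ⊢; linarith
  have hpl : 0.029458495928 ^ 2 ≤ p := by
    rw [hp, le_div_iff₀ hpos]; norm_num at hu ⊢; linarith
  have hpu : p < 0.029458495929 ^ 2 := by
    rw [hp, div_lt_iff₀ hpos]; norm_num at hl ⊢; linarith
  have hdl : 0.00303351 ^ 2 ≤ p - s ^ 2 := by norm_num at hpl hsu hsl ⊢; nlinarith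
  have hdu : p - s ^ 2 < 0.00303352 ^ 2 := by norm_num at hpu hsu hsl ⊢; nlinarith
  have hd0 : 0 ≤ p - s ^ 2 := le_trans (by positivity) hdl
  obtain ⟨d, hd⟩ : ∃ d, d = √(p - s ^ 2) := ⟨_, rfl⟩
  have hdd : d ^ 2 = p - s ^ 2 := by rw [hd, Real.sq_sqrt hd0]
  have hsum : (⟨s, d⟩ : ℂ) + ⟨s, -d⟩ + (N : ℂ) = 2359989 / 108 := by
    apply Complex.ext <;> simp
    rw [hs]; ring
  have hprod : (⟨s, d⟩ : ℂ) * ⟨s, -d⟩ = p := by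
    apply Complex.ext <;> simp
    · linear_combination hdd
    · ring
  have hmix : (⟨s, d⟩ : ℂ) * ⟨s, -d⟩ + ⟨s, d⟩ * N + ⟨s, -d⟩ * N = 138304 / 108 := by
    have : p + 2 * s * N = 138304 / 108 := by
      have : N * (p + 2 * s * N) = N * (138304 / 108) := by
        rw [hs]; linear_combination hpN - hN / 108
      exact mul_left_cancel₀ hpos.ne' this
    have h2 : (⟨s, d⟩ : ℂ) + ⟨s, -d⟩ = (2 * s : ℝ) := by
      apply Complex.ext <;> simp
      ring
    rw [hprod, add_assoc, ← add_mul, h2]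
    have h3 := congrArg (fun r : ℝ => (r : ℂ)) this
    push_cast at h3 ⊢
    linear_combination h3
  have hvol : (⟨s, d⟩ : ℂ) * ⟨s, -d⟩ * N = 2048 / 108 := by
    have h3 := congrArg (fun r : ℝ => (r : ℂ)) hpN
    push_cast at h3
    rw [hprod, h3]
  refine ⟨⟨s, d⟩, ⟨s, -d⟩, N, indicialPoly_eq_of_factors hsum hmix hvol, ⟨hsum, hmix, hvol⟩,
    ⟨⟨?_, ?_⟩, ⟨?_, ?_⟩⟩, rfl, ⟨by norm_num at hl ⊢; linarith, by norm_num at hu ⊢; linarith⟩, ?_⟩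
  · show (0.02930189 : ℝ) ≤ s
    norm_num at hsl ⊢; linarith
  · show s < (0.02930190 : ℝ)
    norm_num at hsu ⊢; linarith
  · show (0.00303351 : ℝ) ≤ d
    rw [hd]
    exact Real.le_sqrt_of_sq_le hdl
  · show d < (0.00303352 : ℝ)
    rw [hd, Real.sqrt_lt' (by norm_num)]
    exact hdu
  · have hn : ‖(⟨s, d⟩ : ℂ)‖ = √p := by
      rw [Complex.norm_def, Complex.normSq_mk]
      congr 1
      linear_combination hdd
    rw [hn]
    exact ⟨Real.le_sqrt_of_sq_le hpl, (Real.sqrt_lt' (by norm_num)).2 hpu⟩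

/-! ### The moments along the segment -/

/-- The parametrized line through `-1 - 2i` and `-1 + 2i`. -/
noncomputable def segLine (t : ℝ) : ℂ := -1 + (4 * t - 2) * I

/-- The coordinate `w = (x² - 25) / 5` on that line. -/
noncomputable def segCoord (t : ℝ) : ℂ := (segLine t ^ 2 - 25) / 5

/-- The rational function whose powers are integrated, in the coordinate `w`. -/
noncomputable def phase {F : Type*} [Field F] (w : F) : F :=
  (w + 5) * (5 * w ^ 2 + 56 * w + 160) ^ 2 / w ^ 3

theorem phase_mul_zpow {F : Type*} [Field F] {w : F} (hw : w ≠ 0) (k : ℤ) :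
    phase w * w ^ k = 128000 * w ^ (k + (-3)) + 115200 * w ^ (k + (-2)) + 41600 * w ^ (k + (-1))
      + 7536 * w ^ k + 685 * w ^ (k + 1) + 25 * w ^ (k + 2) := by
  simp only [zpow_add₀ hw, phase, zpow_neg, zpow_ofNat]
  field_simp
  ring

/-- The moments `∫ hⁿ wᵏ dx` along the segment. -/
noncomputable def segMoment (n : ℕ) (k : ℤ) : ℂ :=
  ∫ t in (0 : ℝ)..1, phase (segCoord t) ^ n * segCoord t ^ k * (4 * I)

theorem segLine_re (t : ℝ) : (segLine t).re = -1 := by simp [segLine]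

theorem segCoord_ne_zero (t : ℝ) : segCoord t ≠ 0 := by
  intro h
  have h1 : (segLine t - 5) * (segLine t + 5) = 0 := by
    rw [segCoord, div_eq_zero_iff] at h
    rcases h with h | h
    · linear_combination h
    · norm_num at h
  have h2 := segLine_re t
  rcases mul_eq_zero.1 h1 with h | h
  · rw [sub_eq_zero.1 h] at h2; norm_num at h2
  · rw [eq_neg_of_add_eq_zero_left h] at h2; norm_num at h2

theorem hasDerivAt_segLine (t : ℝ) : HasDerivAt segLine (4 * I) t := by
  have h : HasDerivAt (fun t : ℝ => (t : ℂ)) 1 t := Complex.ofRealCLM.hasDerivAt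
  refine ((((h.const_mul 4).sub_const 2).mul_const I).const_add (-1)).congr_deriv ?_
  ring

theorem continuous_segLine : Continuous segLine := by
  unfold segLine; fun_prop

theorem continuous_segCoord : Continuous segCoord := by
  unfold segCoord; have := continuous_segLine; fun_prop

theorem continuous_segCoord_zpow (k : ℤ) : Continuous fun t => segCoord t ^ k :=
  continuous_segCoord.zpow₀ k fun t => .inl (segCoord_ne_zero t)

theorem continuous_phase_segCoord : Continuous fun t => phase (segCoord t) := by
  unfold phase
  have := continuous_segCoord
  exact Continuous.div (by fun_prop) (by fun_prop) fun t => pow_ne_zero _ (segCoord_ne_zero t)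

theorem intervalIntegrable_segMoment (n : ℕ) (k : ℤ) :
    IntervalIntegrable (fun t => phase (segCoord t) ^ n * segCoord t ^ k * (4 * I)) volume 0 1 := by
  have h1 := continuous_segCoord_zpow k
  have h2 := continuous_phase_segCoord
  exact Continuous.intervalIntegrable (by fun_prop) _ _

theorem isMomentFamily_segMoment : IsMomentFamily segMoment := by
  intro n k
  have hI (k : ℤ) := intervalIntegrable_segMoment n k
  simp only [segMoment, ← intervalIntegral.integral_const_mul]
  have hc (c : ℂ) (k : ℤ) := (hI k).const_mul c
  rw [← intervalIntegral.integral_add (hc _ _) (hc _ _),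
    ← intervalIntegral.integral_add ((hc _ _).add (hc _ _)) (hc _ _),
    ← intervalIntegral.integral_add (((hc _ _).add (hc _ _)).add (hc _ _)) (hc _ _),
    ← intervalIntegral.integral_add ((((hc _ _).add (hc _ _)).add (hc _ _)).add (hc _ _)) (hc _ _),
    ← intervalIntegral.integral_add
      (((((hc _ _).add (hc _ _)).add (hc _ _)).add (hc _ _)).add (hc _ _)) (hc _ _)]
  refine intervalIntegral.integral_congr fun t _ => ?_
  linear_combination phase (segCoord t) ^ n * (4 * I) * phase_mul_zpow (segCoord_ne_zero t) k

/-- Since dw = (2x/5) dx and x² = 5(w + 5), the derivative of x wᵏ contains only powers of w. -/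
theorem hasDerivAt_segLine_mul_zpow (k : ℤ) (t : ℝ) :
    HasDerivAt (fun t => segLine t * segCoord t ^ k)
      (((2 * k + 1) * segCoord t ^ k + 10 * k * segCoord t ^ (k - 1)) * (4 * I)) t := by
  have h1 := hasDerivAt_segLine t
  have h2 : HasDerivAt segCoord (2 * segLine t * (4 * I) / 5) t := by
    refine (((h1.pow 2).sub_const 25).div_const 5).congr_deriv ?_
    push_cast
    ring
  have h3 := (hasDerivAt_zpow k _ (.inl (segCoord_ne_zero t))).comp t h2
  refine (h1.mul h3).congr_deriv ?_
  have e : segLine t ^ 2 = 5 * (segCoord t + 5) := by rw [segCoord]; ring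
  have e2 : segCoord t ^ k = segCoord t ^ (k - 1) * segCoord t := by
    rw [← zpow_add_one₀ (segCoord_ne_zero t), sub_add_cancel]
  simp only [Function.comp_apply]
  rw [e2]
  linear_combination (k : ℂ) * segCoord t ^ (k - 1) * 2 / 5 * (4 * I) * e

theorem segMoment_zero_relation (k : ℤ) :
    (2 * k + 1) * segMoment 0 k + 10 * k * segMoment 0 (k - 1) =
      segLine 1 * segCoord 1 ^ k - segLine 0 * segCoord 0 ^ k := by
  have hI (k : ℤ) := intervalIntegrable_segMoment 0 k
  rw [← intervalIntegral.integral_eq_sub_of_hasDerivAt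
    (fun t _ => hasDerivAt_segLine_mul_zpow k t)]
  · simp only [segMoment, ← intervalIntegral.integral_const_mul]
    rw [← intervalIntegral.integral_add ((hI _).const_mul _) ((hI _).const_mul _)]
    refine intervalIntegral.integral_congr fun t _ => ?_
    ring
  · have h1 := continuous_segCoord_zpow k
    have h2 := continuous_segCoord_zpow (k - 1)
    exact Continuous.intervalIntegrable (by fun_prop) _ _

theorem segLine_one : segLine 1 = -1 + 2 * I := by norm_num [segLine]
theorem segLine_zero : segLine 0 = -1 - 2 * I := by norm_num [segLine]; ring
theorem segCoord_one : segCoord 1 = -28 / 5 - 4 / 5 * I := by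
  rw [segCoord, segLine_one]; ring_nf; rw [I_sq]; ring
theorem segCoord_zero : segCoord 0 = -28 / 5 + 4 / 5 * I := by
  rw [segCoord, segLine_zero]; ring_nf; rw [I_sq]; ring

/-- The combination 160, 56, 5 of the relations for x wᵏ⁺¹, x wᵏ⁺², x wᵏ⁺³ has boundary factor 5w² +
56w + 160, which vanishes at both endpoints. -/
theorem integratesByParts_segMoment : IntegratesByParts segMoment 0 := by
  intro k
  have b1 := segMoment_zero_relation (k + 1)
  have b2 := segMoment_zero_relation (k + 2)
  have b3 := segMoment_zero_relation (k + 3)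
  have e0 : 5 * segCoord 0 ^ 2 + 56 * segCoord 0 + 160 = 0 := by
    rw [segCoord_zero]; ring_nf; rw [I_sq]; ring
  have e1 : 5 * segCoord 1 ^ 2 + 56 * segCoord 1 + 160 = 0 := by
    rw [segCoord_one]; ring_nf; rw [I_sq]; ring
  simp only [zpow_add₀ (segCoord_ne_zero _), zpow_ofNat, add_sub_assoc,
    Int.reduceSub, add_zero] at b1 b2 b3
  push_cast at b1 b2 b3
  simp only [remainderMoment, CharP.cast_eq_zero]
  linear_combination 160 * b1 + 56 * b2 + 5 * b3
    + segLine 1 * segCoord 1 ^ k * segCoord 1 * e1 - segLine 0 * segCoord 0 ^ k * segCoord 0 * e0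

/-- The denominator is (-5w)³ⁿ⁺¹, whose sign cancels (-1)ⁿ⁺¹; its power of 5 cancels those of the
numerator. -/
theorem integralI_eq (n : ℕ) : integralI n = I * segMoment n (-1) := by
  rw [integralI, curveIntegral_segment, segMoment, ← intervalIntegral.integral_const_mul,
    ← intervalIntegral.integral_const_mul]
  refine intervalIntegral.integral_congr fun t _ => ?_
  have hx : (AffineMap.lineMap (-1 - 2 * I) (-1 + 2 * I) t : ℂ) = segLine t := by
    simp [AffineMap.lineMap_apply, segLine]; ring
  have hw : (5 + segLine t) * (5 - segLine t) = -5 * segCoord t := by rw [segCoord]; ring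
  have hs : segLine t ^ 2 = 5 * (segCoord t + 5) := by rw [segCoord]; ring
  have hq : (segLine t + 1 + 2 * I) * (segLine t + 1 - 2 * I) * (segLine t - 1 + 2 * I)
      * (segLine t - 1 - 2 * I) = 5 * (5 * segCoord t ^ 2 + 56 * segCoord t + 160) := by
    have : (segLine t + 1 + 2 * I) * (segLine t + 1 - 2 * I) * (segLine t - 1 + 2 * I)
      * (segLine t - 1 - 2 * I) = (segLine t ^ 2) ^ 2 + 6 * segLine t ^ 2 + 25 := by
      ring_nf; simp only [I_sq, I_pow_four]; ring
    rw [this, hs]; ring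
  have hR : integrandR n (segLine t) =
      (-1) ^ (n + 1) * (phase (segCoord t) ^ n * segCoord t ^ (-1 : ℤ)) := by
    have hden : (5 + segLine t) ^ (3 * n + 1) * (5 - segLine t) ^ (3 * n + 1)
        = (-5 * segCoord t) ^ (3 * n + 1) := by rw [← mul_pow, hw]
    have hnum : 5 * segLine t ^ (2 * n) * (segLine t + 1 + 2 * I) ^ (2 * n)
      * (segLine t + 1 - 2 * I) ^ (2 * n) * (segLine t - 1 + 2 * I) ^ (2 * n)
      * (segLine t - 1 - 2 * I) ^ (2 * n) = 5 * ((5 * (segCoord t + 5)) *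
        (5 * (5 * segCoord t ^ 2 + 56 * segCoord t + 160)) ^ 2) ^ n := by
      rw [← hs, ← hq]
      simp only [mul_pow, ← pow_mul]
      ring
    have hne := segCoord_ne_zero t
    have h5 : (-5 : ℂ) ^ (3 * n + 1) = -5 * (-1) ^ n * 125 ^ n := by
      rw [pow_succ, pow_mul, mul_assoc, ← mul_pow]; norm_num [mul_comm]
    have h6 : ((-1 : ℂ) ^ n) * (-1) ^ n = 1 := by rw [← mul_pow]; simp
    rw [integrandR, hden, hnum, phase, zpow_neg_one, mul_pow (-5 : ℂ), h5, div_pow,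
      pow_succ (segCoord t) (3 * n), pow_mul (segCoord t)]
    have h7 : (5 * (segCoord t + 5) * (5 * (5 * segCoord t ^ 2 + 56 * segCoord t + 160)) ^ 2) ^ n
        = 125 ^ n * ((segCoord t + 5) * (5 * segCoord t ^ 2 + 56 * segCoord t + 160) ^ 2) ^ n := by
      rw [← mul_pow]; congr 1; ring
    have h8 : (-1 : ℂ) ^ n ≠ 0 := pow_ne_zero _ (by norm_num)
    rw [h7, pow_succ (-1 : ℂ), div_eq_iff (by
      simp only [ne_eq, mul_eq_zero, pow_eq_zero_iff', h8, hne]; norm_num)]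
    field_simp
    linear_combination -((
      (segCoord t + 5) * (5 * segCoord t ^ 2 + 56 * segCoord t + 160) ^ 2) ^ n) * h6
  have h6 : ((-1 : ℂ) ^ (n + 1)) * (-1) ^ (n + 1) = 1 := by rw [← mul_pow]; simp
  have hd : (-1 + 2 * I - (-1 - 2 * I) : ℂ) = 4 * I := by ring
  simp only [hx, hd, ContinuousLinearMap.toSpanSingleton_apply, smul_eq_mul, hR]
  linear_combination I * (4 * I) * (phase (segCoord t) ^ n * segCoord t ^ (-1 : ℤ)) * h6

/-- On the segment |x|² ≤ 5, so |w + 5| ≤ 1, |5w² + 56w + 160| ≤ 16 and |w| ≥ 4, whence |h| ≤ 16²/4³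
= 4. Any base below N₃ would suffice. -/
theorem norm_segMoment_le (n : ℕ) : ‖segMoment n (-1)‖ ≤ 4 ^ n := by
  have : ‖segMoment n (-1)‖ ≤ 4 ^ n * |(1 : ℝ) - 0| := by
    refine intervalIntegral.norm_integral_le_of_norm_le_const fun t ht => ?_
    rw [Set.uIoc_of_le zero_le_one] at ht
    have hx : ‖segLine t‖ ^ 2 ≤ 5 := by
      rw [Complex.sq_norm, Complex.normSq_apply]
      simp [segLine]
      nlinarith [ht.1, ht.2]
    have hx2 : ‖segLine t ^ 2‖ ≤ 5 := by rwa [norm_pow]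
    have e1 : segCoord t + 5 = segLine t ^ 2 / 5 := by rw [segCoord]; ring
    have e2 : 5 * segCoord t ^ 2 + 56 * segCoord t + 160 =
      ((segLine t ^ 2) ^ 2 + 6 * segLine t ^ 2 + 25) / 5 := by rw [segCoord]; ring
    have b1 : ‖segCoord t + 5‖ ≤ 1 := by rw [e1, norm_div]; norm_num at hx2 ⊢; linarith
    have b2 : ‖5 * segCoord t ^ 2 + 56 * segCoord t + 160‖ ≤ 16 := by
      rw [e2, norm_div]
      have : ‖(segLine t ^ 2) ^ 2 + 6 * segLine t ^ 2 + 25‖ ≤ 80 := by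
        refine norm_add₃_le.trans ?_
        rw [norm_pow, norm_mul]
        have := norm_nonneg (segLine t ^ 2)
        norm_num at hx2 this ⊢
        nlinarith
      norm_num at this ⊢
      linarith
    have b3 : 4 ≤ ‖segCoord t‖ := by
      have := norm_sub_norm_le (25 : ℂ) (segLine t ^ 2)
      rw [segCoord, norm_div, norm_sub_rev]
      norm_num at this hx2 ⊢
      linarith
    have b4 : ‖phase (segCoord t)‖ ≤ 4 := by
      rw [phase, norm_div, norm_mul, norm_pow, norm_pow, div_le_iff₀ (by positivity)]
      calc _ ≤ (1 : ℝ) * 16 ^ 2 := by gcongr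
        _ = 4 * 4 ^ 3 := by norm_num
        _ ≤ _ := by gcongr
    rw [norm_mul, norm_mul, norm_pow, zpow_neg_one, norm_inv, norm_mul, norm_I]
    calc _ ≤ (4 : ℝ) ^ n * 4⁻¹ * (4 * 1) := by
          gcongr
          norm_num
      _ = 4 ^ n := by ring
  simpa using this

/-! ### Residues as constant terms of Laurent series -/

section Laurent
open LaurentSeries

/-- The Laurent series `20 y / (1 - y)²`, which is `w` in terms of `y = (x - 5) / (x + 5)`. -/
noncomputable def laurentCoord : ℚ⸨X⸩ :=
  20 * HahnSeries.single 1 1 / (1 - HahnSeries.single 1 1) ^ 2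

instance : CharZero ℚ⸨X⸩ := algebraRat.charZero _

theorem one_sub_single_ne_zero : (1 - HahnSeries.single 1 1 : ℚ⸨X⸩) ≠ 0 := by
  intro h
  have := congrArg (fun f : ℚ⸨X⸩ => f.coeff 0) h
  simp at this

theorem single_one_ne_zero : (HahnSeries.single 1 1 : ℚ⸨X⸩) ≠ 0 := by simp

theorem laurentCoord_ne_zero : laurentCoord ≠ 0 :=
  div_ne_zero (mul_ne_zero (by norm_num) single_one_ne_zero) (pow_ne_zero _ one_sub_single_ne_zero)

theorem coeff_zero_single_zpow_mul_coe (m : ℕ) (P : PowerSeries ℚ) :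
    ((HahnSeries.single 1 1 : ℚ⸨X⸩) ^ (-(m : ℤ)) * (P : ℚ⸨X⸩)).coeff 0 = PowerSeries.coeff m P := by
  rw [← RatFunc.single_zpow, HahnSeries.coeff_single_mul, one_mul, PowerSeries.coeff_coe]
  simp

theorem coeff_zero_single_pow_mul_coe (m : ℕ) (P : PowerSeries ℚ) :
    ((HahnSeries.single 1 1 : ℚ⸨X⸩) ^ (m + 1) * (P : ℚ⸨X⸩)).coeff 0 = 0 := by
  rw [← RatFunc.single_one_eq_pow, HahnSeries.coeff_single_mul, one_mul, PowerSeries.coeff_coe,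
    if_pos (by omega)]

theorem inv_one_sub_single :
    (1 - HahnSeries.single 1 1 : ℚ⸨X⸩)⁻¹ = ((PowerSeries.mk 1 : PowerSeries ℚ) : ℚ⸨X⸩) := by
  refine inv_eq_of_mul_eq_one_left ?_
  rw [← PowerSeries.coe_X, ← PowerSeries.coe_one, ← PowerSeries.coe_sub, ← PowerSeries.coe_mul,
    PowerSeries.mk_one_mul_one_sub_eq_one]

theorem coeff_zero_laurentCoord_pow (m : ℕ) : (laurentCoord ^ (m + 1)).coeff 0 = 0 := by
  have : laurentCoord ^ (m + 1) = HahnSeries.single 1 1 ^ (m + 1) *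
      (((20 * (PowerSeries.mk 1) ^ 2) ^ (m + 1) : PowerSeries ℚ) : ℚ⸨X⸩) := by
    rw [PowerSeries.coe_pow, PowerSeries.coe_mul, PowerSeries.coe_pow, ← inv_one_sub_single,
      ← mul_pow, laurentCoord]
    congr 1
    simp only [map_ofNat]
    field_simp
  rw [this, coeff_zero_single_pow_mul_coe]

/-- Since w⁻¹ = (1 - y)²/(20y), this is the middle coefficient of (y - 1)²ʲ divided by 20ʲ. -/
theorem coeff_zero_laurentCoord_zpow_neg (j : ℕ) :
    (laurentCoord ^ (-(j : ℤ))).coeff 0 = (-1 / 20) ^ j * j.centralBinom := by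
  have : laurentCoord ^ (-(j : ℤ)) = HahnSeries.single 1 1 ^ (-(j : ℤ)) *
      ((PowerSeries.C ((1 / 20 : ℚ) ^ j) *
        (((Polynomial.X + Polynomial.C (-1)) ^ (2 * j) : ℚ[X]) : PowerSeries ℚ)
          : PowerSeries ℚ) : ℚ⸨X⸩) := by
    rw [PowerSeries.coe_mul, PowerSeries.coe_C, Polynomial.coe_pow, PowerSeries.coe_pow,
      Polynomial.coe_add, Polynomial.coe_X, PowerSeries.coe_add, PowerSeries.coe_X,
      Polynomial.coe_C, PowerSeries.coe_C, map_pow, laurentCoord, zpow_neg, zpow_neg,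
      zpow_natCast, zpow_natCast, pow_mul, ← inv_pow, ← inv_pow,
      ← mul_pow, ← mul_pow]
    congr 1
    have h1 := one_sub_single_ne_zero
    have h2 := single_one_ne_zero
    simp only [map_div₀, map_neg, map_one, map_ofNat]
    field_simp
    ring
  rw [this, coeff_zero_single_zpow_mul_coe, PowerSeries.coeff_C_mul, Polynomial.coeff_coe,
    Polynomial.coeff_X_add_C_pow, Nat.centralBinom, two_mul, Nat.add_sub_cancel, ← mul_assoc,
    ← mul_pow]
  norm_num

/-- This says that the exact form d(x wᵐ⁻¹) has no residue at y = 0. For m ≤ 0 it is the recurrence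
of the central binomial coefficients. -/
theorem coeff_zero_laurentCoord_relation (m : ℤ) :
    (2 * m - 1) * (laurentCoord ^ m).coeff 0
      + 10 * (m - 1) * (laurentCoord ^ (m - 1)).coeff 0 = 0 := by
  rcases lt_or_ge 0 m with hm | hm
  · obtain ⟨j, rfl⟩ : ∃ j : ℕ, m = j + 1 := ⟨(m - 1).toNat, by omega⟩
    have h1 : (laurentCoord ^ ((j : ℤ) + 1)).coeff 0 = 0 := by
      exact_mod_cast coeff_zero_laurentCoord_pow j
    rw [h1, add_sub_cancel_right, zpow_natCast]
    rcases j with _ | j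
    · simp
    · rw [coeff_zero_laurentCoord_pow]; simp
  · obtain ⟨j, rfl⟩ : ∃ j : ℕ, m = -j := ⟨(-m).toNat, by omega⟩
    have h1 := coeff_zero_laurentCoord_zpow_neg (j + 1)
    have e : -(((j + 1 : ℕ)) : ℤ) = -(j : ℤ) - 1 := by push_cast; ring
    rw [e] at h1
    rw [h1, coeff_zero_laurentCoord_zpow_neg]
    have h2 : ((j : ℚ) + 1) * (j + 1).centralBinom = 2 * (2 * j + 1) * j.centralBinom := by
      exact_mod_cast Nat.succ_mul_centralBinom_succ j
    push_cast
    rw [pow_succ]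
    linear_combination (-1 / 20 : ℚ) ^ j / 2 * h2

/-- The coefficients of `π`: up to the factor `-1/4`, residues of `hⁿ wᵏ`. -/
noncomputable def residueMoment (n : ℕ) (k : ℤ) : ℚ :=
  -- From dx = (w/2) dy/y come the exponent k + 1 and a factor 1/2; the logarithm of y changes by
  -- -πi/2 along the segment.
  -1 / 4 * (phase laurentCoord ^ n * laurentCoord ^ (k + 1)).coeff 0

theorem residueMoment_succ (n : ℕ) (k : ℤ) : residueMoment (n + 1) k =
    128000 * residueMoment n (k + (-3)) + 115200 * residueMoment n (k + (-2))
      + 41600 * residueMoment n (k + (-1)) + 7536 * residueMoment n k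
      + 685 * residueMoment n (k + 1) + 25 * residueMoment n (k + 2) := by
  have h : phase laurentCoord ^ (n + 1) * laurentCoord ^ (k + 1) =
      HahnSeries.C 128000 * (phase laurentCoord ^ n * laurentCoord ^ (k + (-3) + 1))
      + HahnSeries.C 115200 * (phase laurentCoord ^ n * laurentCoord ^ (k + (-2) + 1))
      + HahnSeries.C 41600 * (phase laurentCoord ^ n * laurentCoord ^ (k + (-1) + 1))
      + HahnSeries.C 7536 * (phase laurentCoord ^ n * laurentCoord ^ (k + 1))
      + HahnSeries.C 685 * (phase laurentCoord ^ n * laurentCoord ^ (k + 1 + 1))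
      + HahnSeries.C 25 * (phase laurentCoord ^ n * laurentCoord ^ (k + 2 + 1)) := by
    simp only [map_ofNat]
    simp only [zpow_add_one₀ laurentCoord_ne_zero]
    linear_combination phase laurentCoord ^ n * laurentCoord *
      phase_mul_zpow laurentCoord_ne_zero k + (phase laurentCoord ^ n * laurentCoord * 685) *
        zpow_add_one₀ laurentCoord_ne_zero k
  simp only [residueMoment, h, HahnSeries.coeff_add, HahnSeries.C_apply,
    HahnSeries.coeff_single_zero_mul]
  ring

theorem residueMoment_zero_relation (k : ℤ) :
    (2 * k + 1) * residueMoment 0 k + 10 * k * residueMoment 0 (k - 1) = 0 := by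
  have := coeff_zero_laurentCoord_relation (k + 1)
  simp only [residueMoment, pow_zero, one_mul, sub_add_cancel]
  rw [add_sub_cancel_right] at this
  push_cast at this
  linear_combination -1 / 4 * this

theorem residueMoment_zero_neg_one : residueMoment 0 (-1) = -1 / 4 := by
  simp [residueMoment]

theorem isMomentFamily_residueMoment : IsMomentFamily fun n k => (residueMoment n k : ℂ) := by
  intro n k
  simp only [residueMoment_succ n k]
  push_cast
  ring

theorem integratesByParts_residueMoment :
    IntegratesByParts (fun n k => (residueMoment n k : ℂ)) 0 := by
  intro k
  have b (j : ℤ) : (2 * j + 1) * (residueMoment 0 j : ℂ)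
      + 10 * j * (residueMoment 0 (j - 1) : ℂ) = 0 := by
    exact_mod_cast congrArg (fun q : ℚ => (q : ℂ)) (residueMoment_zero_relation j)
  have b1 := b (k + 1)
  have b2 := b (k + 2)
  have b3 := b (k + 3)
  simp only [add_sub_assoc, Int.reduceSub, add_zero] at b1 b2 b3
  push_cast at b1 b2 b3
  simp only [remainderMoment, CharP.cast_eq_zero]
  linear_combination 160 * b1 + 56 * b2 + 5 * b3

/-- The power series `y³ h` in the variable `y`. -/
noncomputable def growthSeries : PowerSeries ℚ :=
  4 * (1 + PowerSeries.X) ^ 2 * (2 + 6 * PowerSeries.X + 9 * PowerSeries.X ^ 2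
    + 6 * PowerSeries.X ^ 3 + 2 * PowerSeries.X ^ 4) ^ 2 * (PowerSeries.mk 1) ^ 4

theorem phase_laurentCoord :
    phase laurentCoord = HahnSeries.single 1 1 ^ (-3 : ℤ) * (growthSeries : ℚ⸨X⸩) := by
  simp only [growthSeries, PowerSeries.coe_mul, PowerSeries.coe_pow, PowerSeries.coe_add,
    map_ofNat, ← inv_one_sub_single, PowerSeries.coe_X, PowerSeries.coe_one, phase, laurentCoord]
  have h1 := one_sub_single_ne_zero
  have h2 := single_one_ne_zero
  simp only [zpow_neg, zpow_ofNat]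
  field_simp
  ring

theorem residueMoment_neg_one (n : ℕ) :
    residueMoment n (-1) = -1 / 4 * PowerSeries.coeff (3 * n) (growthSeries ^ n) := by
  rw [residueMoment, phase_laurentCoord, neg_add_cancel, zpow_zero, mul_one, mul_pow,
    ← PowerSeries.coe_pow, ← zpow_natCast, ← zpow_mul, ← coeff_zero_single_zpow_mul_coe]
  congr 5

end Laurent

/-! ### Positivity and monotonicity of the coefficients of π -/

theorem one_le_coeff_mul {P Q : PowerSeries ℚ} (hP : ∀ k, 1 ≤ PowerSeries.coeff k P)
    (hQ : ∀ k, 0 ≤ PowerSeries.coeff k Q) (hQ0 : 1 ≤ PowerSeries.coeff 0 Q) (k : ℕ) :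
    1 ≤ PowerSeries.coeff k (Q * P) := by
  rw [PowerSeries.coeff_mul]
  calc (1 : ℚ) ≤ PowerSeries.coeff 0 Q * PowerSeries.coeff k P :=
        one_le_mul_of_one_le_of_one_le hQ0 (hP k)
    _ ≤ _ := Finset.single_le_sum (f := fun p : ℕ × ℕ =>
        PowerSeries.coeff p.1 Q * PowerSeries.coeff p.2 P)
        (fun p _ => mul_nonneg (hQ _) (zero_le_one.trans (hP _)))
        (Finset.HasAntidiagonal.mem_antidiagonal.2 (zero_add k) :
          (0, k) ∈ Finset.HasAntidiagonal.antidiagonal k)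

theorem coeff_mul_nonneg {P Q : PowerSeries ℚ} (hP : ∀ k, 0 ≤ PowerSeries.coeff k P)
    (hQ : ∀ k, 0 ≤ PowerSeries.coeff k Q) (k : ℕ) : 0 ≤ PowerSeries.coeff k (P * Q) := by
  rw [PowerSeries.coeff_mul]
  exact Finset.sum_nonneg fun p _ => mul_nonneg (hP _) (hQ _)

/-- The factor (1 - y)⁻⁴ has all coefficients at least 1; the remaining factor has nonnegative
coefficients and constant term 16. -/
theorem one_le_coeff_growthSeries (k : ℕ) : 1 ≤ PowerSeries.coeff k growthSeries := by
  have hX (j k : ℕ) : 0 ≤ PowerSeries.coeff k (PowerSeries.X ^ j : PowerSeries ℚ) := by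
    rw [PowerSeries.coeff_X_pow]; split_ifs <;> norm_num
  have hC (c : ℚ) (hc : 0 ≤ c) (k : ℕ) : 0 ≤ PowerSeries.coeff k (PowerSeries.C c) := by
    rw [PowerSeries.coeff_C]; split_ifs <;> simp [hc]
  have hadd {P Q : PowerSeries ℚ} (hP : ∀ k, 0 ≤ PowerSeries.coeff k P)
      (hQ : ∀ k, 0 ≤ PowerSeries.coeff k Q) (k : ℕ) : 0 ≤ PowerSeries.coeff k (P + Q) := by
    rw [map_add]; exact add_nonneg (hP k) (hQ k)
  have h1 : ∀ k, 0 ≤ PowerSeries.coeff k (1 + PowerSeries.X : PowerSeries ℚ) :=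
    hadd (by simpa using hX 0) (by simpa using hX 1)
  have hq : ∀ k, 0 ≤ PowerSeries.coeff k (PowerSeries.C 2 + PowerSeries.C 6 * PowerSeries.X
      + PowerSeries.C 9 * PowerSeries.X ^ 2 + PowerSeries.C 6 * PowerSeries.X ^ 3
      + PowerSeries.C 2 * PowerSeries.X ^ 4 : PowerSeries ℚ) :=
    hadd (hadd (hadd (hadd (hC _ (by norm_num))
      (coeff_mul_nonneg (hC _ (by norm_num)) (by simpa using hX 1)))
      (coeff_mul_nonneg (hC _ (by norm_num)) (hX _)))
      (coeff_mul_nonneg (hC _ (by norm_num)) (hX _)))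
      (coeff_mul_nonneg (hC _ (by norm_num)) (hX _))
  have hgeom : ∀ k, 1 ≤ PowerSeries.coeff k (PowerSeries.mk 1 : PowerSeries ℚ) := by simp
  have hmul {P Q : PowerSeries ℚ} (hP : ∀ k, 1 ≤ PowerSeries.coeff k P)
      (hQ : ∀ k, 1 ≤ PowerSeries.coeff k Q) : ∀ k, 1 ≤ PowerSeries.coeff k (P * Q) :=
    one_le_coeff_mul hQ (fun k => zero_le_one.trans (hP k)) (hP 0)
  have e : growthSeries = PowerSeries.C 4 * ((1 + PowerSeries.X) * (1 + PowerSeries.X))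
      * ((PowerSeries.C 2 + PowerSeries.C 6 * PowerSeries.X
      + PowerSeries.C 9 * PowerSeries.X ^ 2 + PowerSeries.C 6 * PowerSeries.X ^ 3
      + PowerSeries.C 2 * PowerSeries.X ^ 4) * (PowerSeries.C 2 + PowerSeries.C 6 * PowerSeries.X
      + PowerSeries.C 9 * PowerSeries.X ^ 2 + PowerSeries.C 6 * PowerSeries.X ^ 3
      + PowerSeries.C 2 * PowerSeries.X ^ 4)) * (PowerSeries.mk 1 * PowerSeries.mk 1
        * (PowerSeries.mk 1 * PowerSeries.mk 1)) := by
    rw [growthSeries]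
    simp only [map_ofNat]
    ring
  rw [e]
  refine one_le_coeff_mul (hmul (hmul hgeom hgeom) (hmul hgeom hgeom))
    (coeff_mul_nonneg (coeff_mul_nonneg (hC _ (by norm_num)) (coeff_mul_nonneg h1 h1))
      (coeff_mul_nonneg hq hq)) ?_ k
  simp only [PowerSeries.coeff_zero_eq_constantCoeff_apply, map_mul, map_add, map_pow, map_one,
    PowerSeries.constantCoeff_C, PowerSeries.constantCoeff_X]
  norm_num

theorem coeff_growthSeries_pow_nonneg (n k : ℕ) :
    0 ≤ PowerSeries.coeff k (growthSeries ^ n) := by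
  induction n generalizing k with
  | zero => rw [pow_zero, PowerSeries.coeff_one]; split_ifs <;> norm_num
  | succ n ih =>
    rw [pow_succ]
    exact coeff_mul_nonneg ih (fun k => zero_le_one.trans (one_le_coeff_growthSeries k)) k

/-- The index pair (3n, 3) contributes one term of a nonnegative convolution, and its second factor
is at least 1. -/
theorem coeff_growthSeries_pow_le (n : ℕ) :
    PowerSeries.coeff (3 * n) (growthSeries ^ n) ≤
      PowerSeries.coeff (3 * (n + 1)) (growthSeries ^ (n + 1)) := by
  rw [pow_succ, PowerSeries.coeff_mul]
  calc _ ≤ PowerSeries.coeff (3 * n) (growthSeries ^ n) * PowerSeries.coeff 3 growthSeries :=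
        le_mul_of_one_le_right (coeff_growthSeries_pow_nonneg n _) (one_le_coeff_growthSeries 3)
    _ ≤ _ := Finset.single_le_sum (f := fun p : ℕ × ℕ =>
        PowerSeries.coeff p.1 (growthSeries ^ n) * PowerSeries.coeff p.2 growthSeries)
        (fun p _ => mul_nonneg (coeff_growthSeries_pow_nonneg n _)
          (zero_le_one.trans (one_le_coeff_growthSeries _)))
        (Finset.HasAntidiagonal.mem_antidiagonal.2 (by ring) :
          (3 * n, 3) ∈ Finset.HasAntidiagonal.antidiagonal (3 * (n + 1)))

/-- The coefficient of `π` in `I_n`. -/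
noncomputable def piCoeff (n : ℕ) : ℚ := -residueMoment n (-1)

theorem piCoeff_zero : piCoeff 0 = 1 / 4 := by
  rw [piCoeff, residueMoment_zero_neg_one]; norm_num

theorem monotone_piCoeff : Monotone piCoeff := by
  refine monotone_nat_of_le_succ fun n => ?_
  simp only [piCoeff, residueMoment_neg_one]
  linarith [coeff_growthSeries_pow_le n]

theorem piCoeff_pos (n : ℕ) : 0 < piCoeff n := by
  have := monotone_piCoeff (Nat.zero_le n)
  rw [piCoeff_zero] at this
  linarith

/-! ### The decomposition a + bπ -/

theorem arg_one_add_I : (1 + I).arg = Real.pi / 4 := by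
  have h := Complex.arg_mul_cos_add_sin_mul_I (r := √2) (θ := Real.pi / 4) (by positivity)
    ⟨by linarith [Real.pi_pos], by linarith [Real.pi_pos]⟩
  rw [← h]
  congr 1
  have h2 : ((√2 : ℝ) : ℂ) * (√2 : ℝ) = 2 := by
    rw [← ofReal_mul, Real.mul_self_sqrt (by norm_num)]; norm_num
  have e : ((Real.pi / 4 : ℝ) : ℂ) = (Real.pi : ℂ) / 4 := by push_cast; rfl
  rw [← Complex.ofReal_cos, ← Complex.ofReal_sin, Real.cos_pi_div_four, Real.sin_pi_div_four]
  push_cast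
  linear_combination -(1 + I) / 2 * h2

theorem log_one_sub_I_sub : Complex.log (1 - I) - Complex.log (1 + I) = -(Real.pi / 2) * I := by
  have hc : (1 - I : ℂ) = starRingEnd ℂ (1 + I) := by simp [sub_eq_add_neg]
  rw [hc, Complex.log_conj _ (by rw [arg_one_add_I]; linarith [Real.pi_pos])]
  apply Complex.ext
  · simp
  · simp only [sub_im, conj_im, log_im, arg_one_add_I, mul_im, neg_re, neg_im, div_ofNat_re,
      ofReal_re, div_ofNat_im, ofReal_im, I_re, I_im]
    ring

/-- An antiderivative is ½ log((5 - x)/(5 + x)). The quotient has positive real part because |x| <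
5, so the branch cut is avoided; it runs from 1 + i to 1 - i. -/
theorem segMoment_zero_neg_one : segMoment 0 (-1) = -(Real.pi / 4) * I := by
  have hne5 (t : ℝ) : 5 + segLine t ≠ 0 := by
    intro h
    have := segLine_re t
    rw [eq_neg_of_add_eq_zero_right h] at this
    norm_num at this
  have hslit (t : ℝ) (ht : t ∈ Set.uIcc (0 : ℝ) 1) :
      (5 - segLine t) / (5 + segLine t) ∈ slitPlane := by
    rw [Set.uIcc_of_le zero_le_one] at ht
    left
    have hpos : 0 < normSq (5 + segLine t) := normSq_pos.2 (hne5 t)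
    rw [div_re, ← add_div]
    refine div_pos ?_ hpos
    simp [segLine]
    nlinarith [ht.1, ht.2]
  have hder : ∀ t ∈ Set.uIcc (0 : ℝ) 1,
      HasDerivAt (fun t => 1 / 2 * Complex.log ((5 - segLine t) / (5 + segLine t)))
        (phase (segCoord t) ^ 0 * segCoord t ^ (-1 : ℤ) * (4 * I)) t := by
    intro t ht
    have h1 := hasDerivAt_segLine t
    have h2 := ((h1.const_sub 5).div (h1.const_add 5) (hne5 t)).clog_real (hslit t ht)
    refine (h2.const_mul (1 / 2)).congr_deriv ?_
    have h5 : 5 - segLine t ≠ 0 := fun h => by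
      have := slitPlane_ne_zero (hslit t ht)
      rw [h, zero_div] at this
      exact this rfl
    have hw := segCoord_ne_zero t
    have e : segCoord t = -((5 - segLine t) * (5 + segLine t)) / 5 := by rw [segCoord]; ring
    rw [zpow_neg_one, e]
    have := hne5 t
    simp only [Pi.div_apply]
    field_simp
    ring
  rw [segMoment, intervalIntegral.integral_eq_sub_of_hasDerivAt hder
    (intervalIntegrable_segMoment 0 (-1))]
  have e1 : (5 - segLine 1) / (5 + segLine 1) = 1 - I := by
    rw [div_eq_iff (hne5 1), segLine_one]; ring_nf; rw [I_sq]; ring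
  have e0 : (5 - segLine 0) / (5 + segLine 0) = 1 + I := by
    rw [div_eq_iff (hne5 0), segLine_zero]; ring_nf; rw [I_sq]; ring
  rw [e1, e0]
  linear_combination 1 / 2 * log_one_sub_I_sub

theorem exists_rat_zpow_segCoord (k : ℤ) :
    ∃ p q : ℚ, segCoord 1 ^ k = p + q * I ∧ segCoord 0 ^ k = p - q * I := by
  have hmul {u v u' v' : ℂ} (h : ∃ p q : ℚ, u = p + q * I ∧ v = p - q * I)
      (h' : ∃ p q : ℚ, u' = p + q * I ∧ v' = p - q * I) :
      ∃ p q : ℚ, u * u' = p + q * I ∧ v * v' = p - q * I := by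
    obtain ⟨p, q, rfl, rfl⟩ := h
    obtain ⟨p', q', rfl, rfl⟩ := h'
    refine ⟨p * p' - q * q', p * q' + q * p', ?_, ?_⟩ <;>
    · push_cast
      linear_combination (q * q' : ℂ) * I_sq
  induction k using Int.induction_on with
  | zero => exact ⟨1, 0, by simp, by simp⟩
  | succ k ih =>
    rw [zpow_add_one₀ (segCoord_ne_zero _), zpow_add_one₀ (segCoord_ne_zero _)]
    refine hmul ih ⟨-28 / 5, -4 / 5, ?_, ?_⟩
    · rw [segCoord_one]; push_cast; ring
    · rw [segCoord_zero]; push_cast; ring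
  | pred k ih =>
    rw [zpow_sub_one₀ (segCoord_ne_zero _), zpow_sub_one₀ (segCoord_ne_zero _)]
    refine hmul ih ⟨-7 / 40, 1 / 40, ?_, ?_⟩
    · refine inv_eq_of_mul_eq_one_left ?_
      rw [segCoord_one]; push_cast; linear_combination (-1 / 50 : ℂ) * I_sq
    · refine inv_eq_of_mul_eq_one_left ?_
      rw [segCoord_zero]; push_cast; linear_combination (-1 / 50 : ℂ) * I_sq

/-- The boundary values of x wᵏ are conjugate elements of ℚ(i), so their difference is a rational
multiple of i. -/
theorem segMoment_zero_rational_relation (k : ℤ) :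
    ∃ r : ℚ, (2 * k + 1) * segMoment 0 k + 10 * k * segMoment 0 (k - 1) = r * I := by
  obtain ⟨p, q, h1, h0⟩ := exists_rat_zpow_segCoord k
  refine ⟨4 * p - 2 * q, ?_⟩
  rw [segMoment_zero_relation, h1, h0, segLine_one, segLine_zero]
  push_cast
  ring

/-- The residue moments solve the homogeneous form of the same relation. From k = -1 it can be
solved upwards, as 2k + 1 is odd, and downwards, as 10k ≠ 0 for k ≤ -1. -/
theorem exists_rat_segMoment_zero (k : ℤ) :
    ∃ r : ℚ, segMoment 0 k = I * (r + residueMoment 0 k * Real.pi) := by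
  have hβ (k : ℤ) : (2 * k + 1) * (residueMoment 0 k : ℂ)
      + 10 * k * (residueMoment 0 (k - 1) : ℂ) = 0 := by
    exact_mod_cast congrArg (fun q : ℚ => (q : ℂ)) (residueMoment_zero_relation k)
  induction k using Int.inductionOn' (b := -1) with
  | zero =>
    refine ⟨0, ?_⟩
    rw [segMoment_zero_neg_one, residueMoment_zero_neg_one]
    push_cast
    ring
  | succ k _ ih =>
    obtain ⟨r, hr⟩ := ih
    obtain ⟨s, hs⟩ := segMoment_zero_rational_relation (k + 1)
    have hb := hβ (k + 1)
    have hne : (2 * ((k + 1 : ℤ) : ℂ) + 1) ≠ 0 := by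
      norm_cast; omega
    rw [add_sub_cancel_right, hr] at hs
    rw [add_sub_cancel_right] at hb
    refine ⟨(s - 10 * (k + 1 : ℤ) * r) / (2 * (k + 1 : ℤ) + 1), mul_left_cancel₀ hne ?_⟩
    push_cast at hne hs hb ⊢
    field_simp
    linear_combination hs - I * Real.pi * hb
  | pred k hk ih =>
    obtain ⟨r, hr⟩ := ih
    obtain ⟨s, hs⟩ := segMoment_zero_rational_relation k
    have hb := hβ k
    have hne : (10 * (k : ℂ)) ≠ 0 := by
      norm_cast; omega
    rw [hr] at hs
    refine ⟨(s - (2 * k + 1) * r) / (10 * k), mul_left_cancel₀ hne ?_⟩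
    have hk0 : (k : ℂ) ≠ 0 := by norm_cast; omega
    push_cast at hs hb ⊢
    field_simp
    linear_combination hs - I * Real.pi * hb

theorem exists_rat_segMoment (n : ℕ) (k : ℤ) :
    ∃ r : ℚ, segMoment n k = I * (r + residueMoment n k * Real.pi) := by
  induction n generalizing k with
  | zero => exact exists_rat_segMoment_zero k
  | succ n ih =>
    obtain ⟨r1, h1⟩ := ih (k + (-3))
    obtain ⟨r2, h2⟩ := ih (k + (-2))
    obtain ⟨r3, h3⟩ := ih (k + (-1))
    obtain ⟨r4, h4⟩ := ih k
    obtain ⟨r5, h5⟩ := ih (k + 1)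
    obtain ⟨r6, h6⟩ := ih (k + 2)
    refine ⟨128000 * r1 + 115200 * r2 + 41600 * r3 + 7536 * r4 + 685 * r5 + 25 * r6, ?_⟩
    rw [isMomentFamily_segMoment n k, residueMoment_succ, h1, h2, h3, h4, h5, h6]
    push_cast
    ring

theorem exists_rat_integralI (n : ℕ) :
    ∃ r : ℚ, integralI n = (r : ℂ) + (piCoeff n : ℂ) * (Real.pi : ℂ) := by
  obtain ⟨r, hr⟩ := exists_rat_segMoment n (-1)
  refine ⟨-r, ?_⟩
  rw [integralI_eq, hr, piCoeff]
  push_cast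
  linear_combination (r + (residueMoment n (-1) : ℂ) * Real.pi) * I_sq

theorem rat_add_rat_mul_pi_injective {p q p' q' : ℚ}
    (h : (p : ℂ) + q * Real.pi = p' + q' * Real.pi) : p = p' ∧ q = q' := by
  have h' : (p : ℝ) + q * Real.pi = p' + q' * Real.pi := by exact_mod_cast h
  have hq : q = q' := by
    by_contra hne
    have hd : (q : ℝ) - q' ≠ 0 := by
      rw [sub_ne_zero]; exact_mod_cast hne
    refine irrational_pi ⟨(p' - p) / (q - q'), ?_⟩
    push_cast
    rw [div_eq_iff hd]
    linear_combination -h'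
  subst hq
  exact ⟨by exact_mod_cast add_right_cancel h', rfl⟩

theorem segMoment_neg_one_ne_zero (n : ℕ) : segMoment n (-1) ≠ 0 := by
  intro h
  obtain ⟨r, hr⟩ := exists_rat_integralI n
  rw [integralI_eq, h, mul_zero] at hr
  have h0 : ((0 : ℚ) : ℂ) + ((0 : ℚ) : ℂ) * Real.pi = r + piCoeff n * Real.pi := by
    rw [← hr]; simp
  exact (piCoeff_pos n).ne (rat_add_rat_mul_pi_injective h0).2

/-! ### Selecting the growth rate -/

theorem rpow_one_div_eq_exp {x : ℝ} (hx : 0 < x) (n : ℕ) :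
    x ^ (1 / (n : ℝ)) = Real.exp (Real.log x / n) := by
  rw [Real.rpow_def_of_pos hx, mul_one_div]

/-- An exponential upper bound on a sequence bounds its logarithmic growth rate. -/
theorem le_log_of_tendsto_log_div {M : ℕ → ℝ} {C r l : ℝ} (hC : 0 < C) (hr : 0 < r)
    (hM : ∀ᶠ n in atTop, 0 < M n) (h : ∀ᶠ n in atTop, M n ≤ C * r ^ n)
    (hl : Tendsto (fun n : ℕ => Real.log (M n) / n) atTop (𝓝 l)) : l ≤ Real.log r := by
  have h1 := (tendsto_const_div_atTop_nhds_zero_nat (Real.log C)).add_const (Real.log r)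
  rw [zero_add] at h1
  refine le_of_tendsto_of_tendsto hl h1 ?_
  filter_upwards [hM, h, eventually_gt_atTop 0] with n h2 h3 h4
  have h5 := Real.log_le_log h2 h3
  rw [Real.log_mul hC.ne' (by positivity), Real.log_pow] at h5
  have h6 : (0 : ℝ) < n := by exact_mod_cast h4
  rw [div_add' _ _ _ h6.ne']
  gcongr
  linarith

theorem windowSize_pos {a : ℕ → ℂ} (ha : ∀ n, a n ≠ 0) (n : ℕ) : 0 < windowSize a n := by
  have := norm_pos_iff.2 (ha n)
  unfold windowSize
  positivity

section Growth

variable {N₁ N₂ : ℂ} {N₃ : ℝ}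

/-- The dichotomy for moment families whose recurrence has the given characteristic roots. -/
theorem IsMomentFamily.tendsto_log_windowSize_div {L : ℕ → ℤ → ℂ} (hL : IsMomentFamily L)
    (h0 : IntegratesByParts L 0) (hne : ∀ n, L n (-1) ≠ 0)
    (hsum : N₁ + N₂ + N₃ = 2359989 / 108)
    (hmix : N₁ * N₂ + N₁ * N₃ + N₂ * N₃ = 138304 / 108) (hprod : N₁ * N₂ * N₃ = 2048 / 108)
    (hconj : N₂ = starRingEnd ℂ N₁) (him : N₁.im ≠ 0) (hlt : ‖N₁‖ < N₃) :
    Tendsto (fun n : ℕ => Real.log (windowSize (fun n => L n (-1)) n) / n) atTop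
      (𝓝 (Real.log ‖N₁‖)) ∨
    Tendsto (fun n : ℕ => Real.log (windowSize (fun n => L n (-1)) n) / n) atTop
      (𝓝 (Real.log N₃)) := by
  have h3 : ‖(N₃ : ℂ)‖ = N₃ := by
    rw [Complex.norm_real, Real.norm_of_nonneg ((norm_nonneg _).trans hlt.le)]
  have h12 : N₁ ≠ N₂ := by
    intro h
    rw [hconj] at h
    exact him (Complex.conj_eq_iff_im.1 h.symm)
  have h1 : N₁ ≠ 0 := by rintro rfl; exact him rfl
  have := _root_.tendsto_log_windowSize_div (a := fun n => L n (-1)) (N₃ := (N₃ : ℂ)) h12 h1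
    (by rw [hconj, Complex.norm_conj]) (by rwa [h3]) (.of_forall (windowSize_pos hne)) ?_
  · rwa [h3] at this
  · rw [hsum, hmix, hprod]
    refine ((hL.recurrence_isLittleO h0).const_mul_left (1 / 108)).congr_left fun n => ?_
    ring

theorem limsup_norm_integralI (hsum : N₁ + N₂ + N₃ = 2359989 / 108)
    (hmix : N₁ * N₂ + N₁ * N₃ + N₂ * N₃ = 138304 / 108) (hprod : N₁ * N₂ * N₃ = 2048 / 108)
    (hconj : N₂ = starRingEnd ℂ N₁) (him : N₁.im ≠ 0) (hlt : ‖N₁‖ < 1) (hN : 4 < N₃) :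
    limsup (fun n : ℕ => ((‖integralI n‖ ^ (1 / (n : ℝ)) : ℝ) : EReal)) atTop
      = ((‖N₁‖ : ℝ) : EReal) := by
  set a : ℕ → ℂ := fun n => segMoment n (-1) with ha
  have hane : ∀ n, a n ≠ 0 := segMoment_neg_one_ne_zero
  have hMpos := windowSize_pos hane
  have hN1 : 0 < ‖N₁‖ := norm_pos_iff.2 (by rintro rfl; exact him rfl)
  have hnorm (n : ℕ) : ‖integralI n‖ = ‖a n‖ := by rw [integralI_eq, norm_mul, norm_I, one_mul]
  have hlim : Tendsto (fun n : ℕ => Real.log (windowSize a n) / n) atTop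
      (𝓝 (Real.log ‖N₁‖)) := by
    rcases isMomentFamily_segMoment.tendsto_log_windowSize_div integratesByParts_segMoment hane
      hsum hmix hprod hconj him (by linarith) with h | h
    · exact h
    · exfalso
      -- A window is at most (1 + 4 + 16) 4ⁿ, which is incompatible with the rate N₃ > 4.
      have := le_log_of_tendsto_log_div (C := 21) (r := 4) (by norm_num) (by norm_num)
        (.of_forall hMpos) (.of_forall fun n => ?_) h
      · exact absurd this (not_le.2 (Real.log_lt_log (by norm_num) hN))
      · have h0 := norm_segMoment_le n
        have h1 := norm_segMoment_le (n + 1)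
        have h2 := norm_segMoment_le (n + 2)
        rw [pow_succ] at h1
        rw [pow_add] at h2
        simp only [windowSize, ha]
        linarith
  have hroot : Tendsto (fun n : ℕ => windowSize a n ^ (1 / (n : ℝ))) atTop (𝓝 ‖N₁‖) := by
    have := (Real.continuous_exp.tendsto _).comp hlim
    rw [Real.exp_log hN1] at this
    exact this.congr fun n => (rpow_one_div_eq_exp (hMpos n) n).symm
  apply le_antisymm
  · rw [← ((continuous_coe_real_ereal.tendsto _).comp hroot).limsup_eq]
    refine limsup_le_limsup (.of_forall fun n => ?_)
    simp only [Function.comp_apply, EReal.coe_le_coe_iff]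
    refine Real.rpow_le_rpow (norm_nonneg _) ?_ (by positivity)
    rw [hnorm, windowSize, add_assoc]
    exact le_add_of_nonneg_right (by positivity)
  -- If the limsup were below some r < ‖N₁‖, all three terms of a window would eventually be at most
  -- rⁿ, contradicting the rate of the window.
  · by_contra hlt'
    obtain ⟨r, hr1, hr2⟩ := EReal.lt_iff_exists_real_btwn.1 (not_le.1 hlt')
    rw [EReal.coe_lt_coe_iff] at hr2
    have hev : ∀ᶠ n : ℕ in atTop, ‖a n‖ ^ (1 / (n : ℝ)) < r := by
      filter_upwards [eventually_lt_of_limsup_lt hr1] with n hn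
      rw [EReal.coe_lt_coe_iff, hnorm] at hn
      exact hn
    have hrpos : 0 < r := by
      obtain ⟨n, hn⟩ := hev.exists
      exact (Real.rpow_pos_of_pos (norm_pos_iff.2 (hane n)) _).trans hn
    have hpow : ∀ᶠ n : ℕ in atTop, ‖a n‖ ≤ r ^ n := by
      filter_upwards [hev, eventually_gt_atTop 0] with n hn hn0
      calc ‖a n‖ = (‖a n‖ ^ (1 / (n : ℝ))) ^ n := by
            rw [one_div, Real.rpow_inv_natCast_pow (norm_nonneg _) hn0.ne']
        _ ≤ r ^ n := by gcongr
    have := le_log_of_tendsto_log_div (C := 3) (by norm_num) hrpos (.of_forall hMpos) ?_ hlim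
    · exact absurd this (not_le.2 (Real.log_lt_log hrpos hr2))
    · filter_upwards [hpow, (tendsto_add_atTop_nat 1).eventually hpow,
        (tendsto_add_atTop_nat 2).eventually hpow] with n h0 h1 h2
      have hr : r ≤ 1 := (hr2.trans hlt).le
      have h3 := pow_le_pow_of_le_one hrpos.le hr (Nat.le_add_right n 1)
      have h4 := pow_le_pow_of_le_one hrpos.le hr (Nat.le_add_right n 2)
      unfold windowSize
      linarith

theorem tendsto_piCoeff_root (hsum : N₁ + N₂ + N₃ = 2359989 / 108)
    (hmix : N₁ * N₂ + N₁ * N₃ + N₂ * N₃ = 138304 / 108) (hprod : N₁ * N₂ * N₃ = 2048 / 108)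
    (hconj : N₂ = starRingEnd ℂ N₁) (him : N₁.im ≠ 0) (hlt : ‖N₁‖ < 1) (hN : 1 < N₃) :
    Tendsto (fun n : ℕ => (piCoeff n : ℝ) ^ (1 / (n : ℝ))) atTop (𝓝 N₃) := by
  have hpos (n : ℕ) : (0 : ℝ) < piCoeff n := by exact_mod_cast piCoeff_pos n
  have hmono {m n : ℕ} (h : m ≤ n) : (piCoeff m : ℝ) ≤ piCoeff n := by
    exact_mod_cast monotone_piCoeff h
  have hnorm (n : ℕ) : ‖(residueMoment n (-1) : ℂ)‖ = piCoeff n := by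
    have : (residueMoment n (-1) : ℂ) = -((piCoeff n : ℝ) : ℂ) := by
      rw [piCoeff]; push_cast; ring
    rw [this, norm_neg, Complex.norm_real, Real.norm_of_nonneg (hpos n).le]
  have hne (n : ℕ) : (residueMoment n (-1) : ℂ) ≠ 0 :=
    norm_pos_iff.1 (by rw [hnorm]; exact hpos n)
  have hN1 : 0 < ‖N₁‖ := norm_pos_iff.2 (by rintro rfl; exact him rfl)
  set M := windowSize (fun n => (residueMoment n (-1) : ℂ)) with hMdef
  have hMeq (n : ℕ) : M n = piCoeff n + piCoeff (n + 1) + piCoeff (n + 2) := by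
    simp only [hMdef, windowSize, hnorm]
  have hMpos : ∀ n, 0 < M n := windowSize_pos hne
  have hlim : Tendsto (fun n : ℕ => Real.log (M n) / n) atTop (𝓝 (Real.log N₃)) := by
    rcases isMomentFamily_residueMoment.tendsto_log_windowSize_div
      integratesByParts_residueMoment hne hsum hmix hprod hconj him (by linarith) with h | h
    · exfalso
      have h1 := tendsto_const_div_atTop_nhds_zero_nat (Real.log (piCoeff 0))
      have := le_of_tendsto_of_tendsto' h1 h fun n => by
        gcongr
        · exact hpos 0
        · have h2 := hmono (Nat.zero_le n)
          have h3 := hpos (n + 1)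
          have h4 := hpos (n + 2)
          have h5 := hMeq n
          rw [hMdef] at h5
          linarith
      exact absurd this (not_le.2 (Real.log_neg hN1 hlt))
    · exact h
  -- By monotonicity the window lies between b_{n+2} and 3 b_{n+2}, so here the window rate gives a
  -- true limit.
  have hshift : Tendsto (fun n : ℕ => Real.log (piCoeff (n + 2)) / n) atTop
      (𝓝 (Real.log N₃)) := by
    refine tendsto_log_div_of_isTheta (.of_forall hMpos) (.of_forall fun n => hpos (n + 2))
      (.of_bound 3 (.of_forall fun n => ?_)) (.of_bound 1 (.of_forall fun n => ?_)) hlim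
    all_goals
      rw [Real.norm_of_nonneg (hMpos n).le, Real.norm_of_nonneg (hpos (n + 2)).le, hMeq]
      have h0 := hpos n
      have h1 := hpos (n + 1)
      have h2 := hmono (show n ≤ n + 2 by omega)
      have h3 := hmono (show n + 1 ≤ n + 2 by omega)
      linarith
  have hlog : Tendsto (fun n : ℕ => Real.log (piCoeff n) / n) atTop (𝓝 (Real.log N₃)) := by
    rw [← tendsto_add_atTop_iff_nat 2]
    have h1 := hshift.mul (tendsto_natCast_div_add_atTop (𝕜 := ℝ) 2)
    rw [mul_one] at h1
    refine h1.congr' ?_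
    filter_upwards [eventually_gt_atTop 0] with n hn
    have : (n : ℝ) ≠ 0 := by positivity
    push_cast
    field_simp
  have := (Real.continuous_exp.tendsto _).comp hlog
  rw [Real.exp_log (by linarith)] at this
  exact this.congr fun n => (rpow_one_div_eq_exp (hpos n) n).symm

end Growth

theorem proposition2 :
    ∃ (N₁ N₂ : ℂ) (N₃ : ℝ),
      -- the zeros of the polynomial, with multiplicity, and their decimal expansions
      indicialPoly.roots = {N₁, N₂, (N₃ : ℂ)} ∧
      (N₁.re ∈ Set.Ico (0.02930189 : ℝ) 0.02930190 ∧
        N₁.im ∈ Set.Ico (0.00303351 : ℝ) 0.00303352) ∧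
      N₂ = starRingEnd ℂ N₁ ∧
      N₃ ∈ Set.Ico (21851.691396 : ℝ) 21851.691397 ∧
      ‖N₁‖ ∈ Set.Ico (0.029458495928 : ℝ) 0.029458495929 ∧
      -- the upper limit, taken in the extended reals
      limsup (fun n : ℕ => ((‖integralI n‖ ^ (1 / (n : ℝ)) : ℝ) : EReal)) atTop
        = ((‖N₁‖ : ℝ) : EReal) ∧
      -- the rational coefficients `a n`, `b n` exist and are unique, and the growth of `b n`
      ∃ a b : ℕ → ℚ,
        (∀ n, integralI n = (a n : ℂ) + (b n : ℂ) * (Real.pi : ℂ)) ∧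
        (∀ n (p q : ℚ), integralI n = (p : ℂ) + (q : ℂ) * (Real.pi : ℂ) →
          p = a n ∧ q = b n) ∧
        (∀ᶠ n in atTop, 0 < b n) ∧
        Tendsto (fun n : ℕ => (b n : ℝ) ^ (1 / (n : ℝ))) atTop (𝓝 N₃) := by
  obtain ⟨N₁, N₂, N₃, hroots, ⟨hsum, hmix, hprod⟩, ⟨hre, him⟩, hconj, hN₃, hnorm⟩ :=
    exists_indicial_roots
  have him0 : N₁.im ≠ 0 := by
    have := him.1
    norm_num at this
    exact (lt_of_lt_of_le (by norm_num) this).ne'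
  have hlt : ‖N₁‖ < 1 := hnorm.2.trans (by norm_num)
  have hbig : 4 < N₃ := lt_of_lt_of_le (by norm_num) hN₃.1
  choose a ha using exists_rat_integralI
  refine ⟨N₁, N₂, N₃, hroots, ⟨hre, him⟩, hconj, hN₃, hnorm,
    limsup_norm_integralI hsum hmix hprod hconj him0 hlt hbig, a, piCoeff, ha,
    fun n p q h => ?_, .of_forall piCoeff_pos,
    tendsto_piCoeff_root hsum hmix hprod hconj him0 hlt (by linarith)⟩
  rw [ha n] at h
  exact (rat_add_rat_mul_pi_injective h).imp Eq.symm Eq.symm
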